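/- Let $S\in\{s_0,s_1\}$ be a binary secret and $Y\in\{0,1\}$ a binary state with a given joint law $\mathbb P(S,Y)$. Assume $\mathbb P(S=s_0),\mathbb P(S=s_1)>0$, put $q_s=\mathbb P(Y=1\mid S=s)$, and assume $q_{s_0}\ge q_{s_1}$. Let $\varepsilon\ge 0$. An *information structure* is a joint law $\mathbb P(S,Y,T)$ with the given $(S,Y)$-marginal, where the signal $T$ is discrete; put $q_t=\mathbb P(Y=1\mid T=t)$. It is *$\varepsilon$-inferentially private* if $\mathbb P(T=t\mid S=s)\le e^{\varepsilon}\,\mathbb P(T=t\mid S=s')$ for all $s,s',t$. It *Blackwell dominates* $\mathbb P(S,Y,T')$ if $\mathbb P(Y,T')$ arises from $\mathbb P(Y,T)$ by drawing $T'$ from a kernel depending on $T$ only (i.e. $Y\to T\to T'$ is a Markov chain, for a suitable coupling). It is *$\varepsilon$-inferentially-private Blackwell optimal* if it is $\varepsilon$-inferentially private and every $\varepsilon$-inferentially-private structure that Blackwell dominates it is also Blackwell dominated by it. Let $R_1=q_{s_0}/q_{s_1}$ and $R_2=(1-q_{s_1})/(1-q_{s_0})$ in $[0,\infty]$, where $x/0=\infty$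 for $x>0$ and $0/0=0$. Then there is an information structure with at most four signals $t_1,t_2,t_3,t_4$ (some may have probability $0$), whose widths $l_i^{(j)}=\mathbb P(T=t_i\mid S=s_j)$ are as follows. * $l_1^{(1)}=q_{s_1}$, $\;l_4^{(0)}=1-q_{s_0}$, $\;l_2^{(0)}=e^{\varepsilon}l_2^{(1)}$, $\;l_3^{(1)}=e^{\varepsilon}l_3^{(0)}$, $\;l_1^{(0)}\in[e^{-\varepsilon}l_1^{(1)},e^{\varepsilon}l_1^{(1)}]$, $\;l_4^{(1)}\in[e^{-\varepsilon}l_4^{(0)},e^{\varepsilon}l_4^{(0)}]$, $\;\sum_{i=1}^4 l_i^{(j)}=1$ and $l_i^{(j)}\ge 0$ for all $i,j$; * if $R_1\le e^\varepsilon$ and $R_2\le e^\varepsilon$: $\;l_2^{(1)}=l_3^{(1)}=0$; * if $R_1\le e^\varepsilon,\ R_2>e^\varepsilon$, or $R_1>e^\varepsilon,\ R_2>e^\varepsilon,\ q_{s_1}\ge\frac1{1+e^{\varepsilon}}$: $\;l_2^{(1)}=0,\ l_3^{(1)}=1-q_{s_1}-e^\varepsilon(1-q_{s_0})$; * if $R_1>e^\varepsilon,\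 R_2\le e^\varepsilon$, or $R_1>e^\varepsilon,\ R_2>e^\varepsilon,\ q_{s_0}\le\frac1{1+e^{-\varepsilon}}$: $\;l_2^{(1)}=e^{-\varepsilon}q_{s_0}-q_{s_1},\ l_3^{(1)}=0$; * if $R_1>e^\varepsilon,\ R_2>e^\varepsilon,\ q_{s_0}>\frac1{1+e^{-\varepsilon}},\ q_{s_1}<\frac1{1+e^{\varepsilon}}$: $\;l_2^{(1)}=\frac1{e^\varepsilon+1}-q_{s_1},\ l_3^{(1)}=e^\varepsilon q_{s_0}-\frac{e^{2\varepsilon}}{e^\varepsilon+1}$. In it, $Y=1$ surely on the cells $(s_0,t_1),(s_0,t_2),(s_0,t_3),(s_1,t_1)$, and $Y=0$ surely on the other four cells. This structure has the following properties. 1. It is $\varepsilon$-inferentially-private Blackwell optimal. 2. It is the unique such structure up to equivalent transformations: every $\varepsilon$-inferentially-private Blackwell-optimal information structure is transformed into it by merging and splitting signals (signals of probability $0$ being ignored). Here signals may be merged (and, inversely, arise by splitting one signal) only if they have the same $\mathbb P(Y=1\mid T=t)$ and the same conditional law $\mathbb P(S,Y\mid T=t)$; the latter is not required of signals with $\mathbb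 P(Y=1\mid T=t)=1$ in case $l_1^{(0)}<e^\varepsilon l_1^{(1)}$, nor of signals with $\mathbb P(Y=1\mid T=t)=0$ in case $l_4^{(1)}<e^\varepsilon l_4^{(0)}$. 3. It maximizes $\mathbb E[u(q_T)]$ among all $\varepsilon$-inferentially-private information structures, for every convex $u:[0,1]\to\mathbb R$ (these expectations converge absolutely). -/

import Mathlib

/-- The prior probability `ℙ(S = s)`, where `π` is the joint law of the binary secret `S` and the
binary state `Y`. -/
noncomputable def priorS (π : PMF (Fin 2 × Fin 2)) (s : Fin 2) : ℝ :=
  ∑ y, (π (s, y)).toReal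

/-- `q_s = ℙ(Y = 1 | S = s)`. -/
noncomputable def qS (π : PMF (Fin 2 × Fin 2)) (s : Fin 2) : ℝ :=
  (π (s, 1)).toReal / priorS π s

/-- `R₁ = q_{s₀} / q_{s₁}` as an element of `[0, ∞]`; it is `∞` if `q_{s₁} = 0 < q_{s₀}`. -/
noncomputable def ratioOne (π : PMF (Fin 2 × Fin 2)) : ENNReal :=
  ENNReal.ofReal (qS π 0) / ENNReal.ofReal (qS π 1)

/-- `R₂ = (1 - q_{s₁}) / (1 - q_{s₀})` as an element of `[0, ∞]`; it is `∞` if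
`q_{s₁} < 1 = q_{s₀}`. -/
noncomputable def ratioTwo (π : PMF (Fin 2 × Fin 2)) : ENNReal :=
  ENNReal.ofReal (1 - qS π 1) / ENNReal.ofReal (1 - qS π 0)

/-- An information structure with signals in `T`: a (discrete) joint law of `(S, Y, T)` whose
`(S, Y)`-marginal is the given prior `π`. -/
structure InfoStructure (π : PMF (Fin 2 × Fin 2)) (T : Type*) where
  joint : PMF (Fin 2 × Fin 2 × T)
  marginal : joint.map (fun x => (x.1, x.2.1)) = π

namespace InfoStructure

variable {π : PMF (Fin 2 × Fin 2)} {T T' : Type*}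

/-- `ℙ(S = s, Y = y, T = t)`. -/
noncomputable def prob (M : InfoStructure π T) (s y : Fin 2) (t : T) : ℝ :=
  (M.joint (s, y, t)).toReal

/-- `ℙ(T = t)`. -/
noncomputable def probT (M : InfoStructure π T) (t : T) : ℝ :=
  ∑ s, ∑ y, M.prob s y t

/-- `ℙ(T = t | S = s)`. -/
noncomputable def width (M : InfoStructure π T) (t : T) (s : Fin 2) : ℝ :=
  (∑ y, M.prob s y t) / priorS π s

/-- `q_t = ℙ(Y = 1 | T = t)`; only used for signals of positive probability. -/
noncomputable def postY (M : InfoStructure π T) (t : T) : ℝ :=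
  (∑ s, M.prob s 1 t) / M.probT t

/-- `ℙ(S = s, Y = y | T = t)`; only used for signals of positive probability. -/
noncomputable def postSY (M : InfoStructure π T) (t : T) (s y : Fin 2) : ℝ :=
  M.prob s y t / M.probT t

/-- `ε`-inferential privacy, with the quotient `ℙ(T = t | S = s₁) / ℙ(T = t | S = s₂) ≤ e^ε`
multiplied out. -/
def IsPrivate (M : InfoStructure π T) (ε : ℝ) : Prop :=
  ∀ (s₁ s₂ : Fin 2) (t : T), M.width t s₁ ≤ Real.exp ε * M.width t s₂

/-- The joint law of `(Y, T)`. -/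
noncomputable def lawYT (M : InfoStructure π T) : PMF (Fin 2 × T) :=
  M.joint.map Prod.snd

/-- `M` Blackwell dominates `M'`: the law of `(Y, T')` is obtained from that of `(Y, T)` by
drawing `T'` from a kernel that depends on `T` alone, that is, `Y → T → T'` is a Markov chain. -/
def Dominates (M : InfoStructure π T) (M' : InfoStructure π T') : Prop :=
  ∃ K : T → PMF T', M'.lawYT = M.lawYT.bind fun x => (K x.2).map (Prod.mk x.1)

/-- `M` is an `ε`-inferentially-private Blackwell-optimal information structure: it is `ε`-private
and every `ε`-private structure that dominates it is Blackwell equivalent to it. Laws being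
discrete, signal types in `Type` are enough for the competitors. -/
def IsBlackwellOptimal (M : InfoStructure π T) (ε : ℝ) : Prop :=
  M.IsPrivate ε ∧
    ∀ (T₁ : Type) (M₁ : InfoStructure π T₁),
      M₁.IsPrivate ε → M₁.Dominates M → M.Dominates M₁

/-- The expected utility `𝔼[u(q_t)]`. -/
noncomputable def expectedUtility (M : InfoStructure π T) (u : ℝ → ℝ) : ℝ :=
  ∑' t, M.probT t * u (M.postY t)

/-- `M'` is obtained from `M` by merging signals (equivalently, `M` is obtained from `M'` by
splitting signals): signal `t` is renamed `f t`, and signals of positive probability that are given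
the same name have the same `ℙ(Y = 1 | T)`, and also the same conditional law of `(S, Y)` unless
that value of `ℙ(Y = 1 | T)` lies in the set `E`. With `E = ∅` only signals whose columns have the
same shape and the same colours can be merged. Signals of probability zero are ignored. -/
def MergesTo (E : Set ℝ) (M : InfoStructure π T) (M' : InfoStructure π T') : Prop :=
  ∃ f : T → T', M'.joint = M.joint.map (fun x => (x.1, x.2.1, f x.2.2)) ∧
    ∀ t, M.probT t ≠ 0 →
      M.postY t = M'.postY (f t) ∧
      (M.postY t ∉ E → ∀ s y, M.postSY t s y = M'.postSY (f t) s y)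

/-- `M` and `M'` are transformed into one another by merging and then splitting signals. -/
def Equivalent (E : Set ℝ) (M : InfoStructure π T) (M' : InfoStructure π T') : Prop :=
  ∃ (T₀ : Type) (M₀ : InfoStructure π T₀), M.MergesTo E M₀ ∧ M'.MergesTo E M₀

end InfoStructure

/-- The feasibility conditions on the widths `l i j = l_{i+1}^{(j)} = ℙ(T = t_{i+1} | S = s_j)`;
the signals `t₁, t₂, t₃, t₄` are `0, 1, 2, 3 : Fin 4`. The two prescribed quotients are multiplied
out, since either column may have width zero. -/
structure Feasible (π : PMF (Fin 2 × Fin 2)) (ε : ℝ) (l : Fin 4 → Fin 2 → ℝ) : Prop where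
  bottom_left : l 0 1 = qS π 1
  top_right : l 3 0 = 1 - qS π 0
  ratio_two : l 1 0 = Real.exp ε * l 1 1
  ratio_three : l 2 1 = Real.exp ε * l 2 0
  range_one : l 0 0 ∈ Set.Icc (Real.exp (-ε) * l 0 1) (Real.exp ε * l 0 1)
  range_four : l 3 1 ∈ Set.Icc (Real.exp (-ε) * l 3 0) (Real.exp ε * l 3 0)
  sum_eq_one : ∀ j, ∑ i, l i j = 1
  nonneg : ∀ i j, 0 ≤ l i j

/-- The closed-form values of `l_2^{(1)} = l 1 1` and `l_3^{(1)} = l 2 1` in the four parameter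
regions. -/
structure ClosedForm (π : PMF (Fin 2 × Fin 2)) (ε : ℝ) (l : Fin 4 → Fin 2 → ℝ) : Prop where
  region_one :
    ratioOne π ≤ ENNReal.ofReal (Real.exp ε) ∧ ratioTwo π ≤ ENNReal.ofReal (Real.exp ε) →
      l 1 1 = 0 ∧ l 2 1 = 0
  region_two :
    (ratioOne π ≤ ENNReal.ofReal (Real.exp ε) ∧ ratioTwo π > ENNReal.ofReal (Real.exp ε)) ∨
    (ratioOne π > ENNReal.ofReal (Real.exp ε) ∧ ratioTwo π > ENNReal.ofReal (Real.exp ε) ∧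
      qS π 1 ≥ 1 / (1 + Real.exp ε)) →
      l 1 1 = 0 ∧ l 2 1 = 1 - qS π 1 - Real.exp ε * (1 - qS π 0)
  region_three :
    (ratioOne π > ENNReal.ofReal (Real.exp ε) ∧ ratioTwo π ≤ ENNReal.ofReal (Real.exp ε)) ∨
    (ratioOne π > ENNReal.ofReal (Real.exp ε) ∧ ratioTwo π > ENNReal.ofReal (Real.exp ε) ∧
      qS π 0 ≤ 1 / (1 + Real.exp (-ε))) →
      l 1 1 = Real.exp (-ε) * qS π 0 - qS π 1 ∧ l 2 1 = 0
  region_four :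
    ratioOne π > ENNReal.ofReal (Real.exp ε) ∧ ratioTwo π > ENNReal.ofReal (Real.exp ε) ∧
      qS π 0 > 1 / (1 + Real.exp (-ε)) ∧ qS π 1 < 1 / (1 + Real.exp ε) →
      l 1 1 = 1 / (Real.exp ε + 1) - qS π 1 ∧
      l 2 1 = Real.exp ε * qS π 0 - Real.exp (2 * ε) / (Real.exp ε + 1)

/-- `M` is the four-signal structure with cell widths `l` whose yellow cells (`Y = 1` surely) are
`(s₀, t₁), (s₀, t₂), (s₀, t₃), (s₁, t₁)` and whose other cells are white (`Y = 0` surely). -/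
structure HasWidths {π : PMF (Fin 2 × Fin 2)} (M : InfoStructure π (Fin 4))
    (l : Fin 4 → Fin 2 → ℝ) : Prop where
  width_eq : ∀ i j, M.width i j = l i j
  yellow_top : ∀ i, i ≠ 3 → M.prob 0 0 i = 0
  white_top : M.prob 0 1 3 = 0
  yellow_bottom : M.prob 1 0 0 = 0
  white_bottom : ∀ i, i ≠ 0 → M.prob 1 1 i = 0

/-- The values of `ℙ(Y = 1 | T)` of those fully revealing signals `t₁` (value `1`) and `t₄`
(value `0`) whose privacy constraint `l_1^{(0)} ≤ e^ε l_1^{(1)}`, respectively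
`l_4^{(1)} ≤ e^ε l_4^{(0)}`, is slack. -/
def slackValues (ε : ℝ) (l : Fin 4 → Fin 2 → ℝ) : Set ℝ :=
  {v | (v = 1 ∧ l 0 0 < Real.exp ε * l 0 1) ∨ (v = 0 ∧ l 3 1 < Real.exp ε * l 3 0)}

open Finset

/-! Write p, q for the prior probabilities of s₀, s₁, e = exp ε, and (a, b) for the masses of Y = 1
and Y = 0 at a signal. Moving cells across the two privacy inequalities gives max(q a - p e b, 0) ≤
(q + p e) ℙ(s₁, 1, t) and max(p b - q e a, 0) ≤ (p + q e) ℙ(s₀, 0, t). The right-hand sides have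
totals fixed by the prior, so two convex functionals of the posterior law are bounded uniformly over
all private structures.

In the four-signal structure t₁ and t₄ reveal Y, while t₂ and t₃ sit exactly at the kinks of the two
hinge functions. A law carried by the kinks and the endpoints dominates every law whose two hinge
totals are no larger (`exists_kernel_of_hinge_le`). If the privacy constraint on t₁ (or t₄) is
tight, the structure attains the corresponding bound. If it is slack, the widths are chosen so that
the corresponding kink carries no mass (`exists_optimal_widths`), and the missing hinge inequality
follows from the other one, or from the totals when both kinks are empty (`tsum_hinge_le`). Hence
the structure dominates every private structure (`HasWidths.exists_kernel`); optimality is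
immediate, and Jensen's inequality gives the utility claim.

For uniqueness, another optimal structure also dominates this one. Equality of second moments then
forces equal posterior laws (`Dominates.samePosteriorLaw`), hence equality in every tight hinge
bound at every signal. This equality determines the conditional law of (S, Y) from the posterior,
except at a fully revealing posterior with slack constraint, where merging is free. Naming signals
by their posterior gives the common merged structure. -/

/-! ### Hinge inequalities suffice for a garbling kernel. -/

theorem exists_unit_mul_eq {x m : ℝ} (hx : 0 ≤ x) (hxm : x ≤ m) :
    ∃ r : ℝ, 0 ≤ r ∧ r ≤ 1 ∧ r * m = x := by
  rcases (hx.trans hxm).eq_or_lt with h | h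
  · exact ⟨0, le_rfl, zero_le_one, by linarith⟩
  · exact ⟨x / m, by positivity, (div_le_one h).2 hxm, div_mul_cancel₀ _ h.ne'⟩

/-- Every summable nonnegative function is a multiple of a probability vector. -/
theorem exists_normalization {T : Type*} [Nonempty T] {g : T → ℝ} {G : ℝ} (hg : ∀ t, 0 ≤ g t)
    (hG : HasSum g G) : ∃ r : T → ℝ, (∀ t, 0 ≤ r t) ∧ HasSum r 1 ∧ ∀ t, G * r t = g t := by
  classical
  have hG0 : 0 ≤ G := hG.nonneg hg
  rcases hG0.eq_or_lt with h | h
  · subst h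
    have hz := (hasSum_zero_iff_of_nonneg hg).1 hG
    obtain ⟨t₀⟩ := ‹Nonempty T›
    refine ⟨fun t => if t = t₀ then 1 else 0, fun t => by positivity, hasSum_ite_eq t₀ 1,
      fun t => by simp [hz]⟩
  · refine ⟨fun t => g t / G, fun t => div_nonneg (hg t) hG0, ?_, fun t => by field_simp⟩
    simpa [h.ne'] using hG.div_const G

/-- Distributing two pure columns `(x, 0)`, `(0, y)` and two columns proportional to
`(c₁, d₁)`, `(c₂, d₂)` over two targets proportional to `(c₁, d₁)`, `(c₂, d₂)`. -/
theorem exists_two_target_split {c₁ d₁ c₂ d₂ x y m₁ m₂ n₁ n₂ : ℝ}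
    (hc₁ : 0 ≤ c₁) (hd₁ : 0 ≤ d₁) (hc₂ : 0 ≤ c₂) (hd₂ : 0 ≤ d₂)
    (hn₁ : 0 ≤ n₁) (hn₂ : 0 ≤ n₂)
    (h₁ : x + c₁ * m₁ + c₂ * m₂ = c₁ * n₁ + c₂ * n₂)
    (h₂ : y + d₁ * m₁ + d₂ * m₂ = d₁ * n₁ + d₂ * n₂) :
    ∃ α β γ δ : ℝ, (0 ≤ α ∧ α ≤ 1) ∧ (0 ≤ β ∧ β ≤ 1) ∧ (0 ≤ γ ∧ γ ≤ 1) ∧ (0 ≤ δ ∧ δ ≤ 1) ∧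
      α * x + β * (c₁ * m₁) + γ * (c₂ * m₂) = c₁ * n₁ ∧
      δ * y + β * (d₁ * m₁) + γ * (d₂ * m₂) = d₁ * n₁ := by
  rcases le_total n₁ m₁ with h | h
  -- Column 1 alone can feed the first target; everything else then adds up to the second by the
  -- balance equations.
  · obtain ⟨β, hβ0, hβ1, hβ⟩ := exists_unit_mul_eq hn₁ h
    refine ⟨0, β, 0, 0, by simp, ⟨hβ0, hβ1⟩, by simp, by simp, ?_, ?_⟩ <;> rw [← hβ] <;> ring
  rcases le_total n₂ m₂ with h' | h'
  · obtain ⟨γ, hγ0, hγ1, hγ⟩ := exists_unit_mul_eq hn₂ h'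
    refine ⟨1, 1, 1 - γ, 1, by simp, by simp, ⟨by linarith, by linarith⟩, by simp, ?_, ?_⟩
    · linear_combination h₁ - c₂ * hγ
    · linear_combination h₂ - d₂ * hγ
  -- Both targets are short: each keeps its own column, and the pure columns fill the two gaps
  -- coordinate by coordinate.
  · have e₁ := mul_le_mul_of_nonneg_left h hc₁
    have e₂ := mul_le_mul_of_nonneg_left h' hc₂
    have e₃ := mul_le_mul_of_nonneg_left h hd₁
    have e₄ := mul_le_mul_of_nonneg_left h' hd₂
    obtain ⟨α, hα0, hα1, hα⟩ := exists_unit_mul_eq (x := c₁ * n₁ - c₁ * m₁) (m := x)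
      (by linarith) (by linarith)
    obtain ⟨δ, hδ0, hδ1, hδ⟩ := exists_unit_mul_eq (x := d₁ * n₁ - d₁ * m₁) (m := y)
      (by linarith) (by linarith)
    exact ⟨α, 1, 0, δ, ⟨hα0, hα1⟩, by simp, by simp, ⟨hδ0, hδ1⟩, by linarith, by linarith⟩

/-- A column `(a, b)` is a nonnegative combination of `(1, 0)`, `(p e, q)`, `(p, q e)`, `(0, 1)`
that uses `(1, 0)` and `(0, 1)` as little as possible. -/
theorem exists_column_decomposition {p q e a b : ℝ} (hp : 0 < p) (hq : 0 < q) (he : 1 ≤ e)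
    (ha : 0 ≤ a) (hb : 0 ≤ b) :
    ∃ u g h d : ℝ, 0 ≤ u ∧ 0 ≤ g ∧ 0 ≤ h ∧ 0 ≤ d ∧ u + p * e * g + p * h = a ∧
      d + q * g + q * e * h = b ∧ q * u = max (q * a - p * e * b) 0 ∧
      p * d = max (p * b - q * e * a) 0 := by
  have he0 : 0 < e := by linarith
  have k₁ : p * b ≤ p * e * b := by nlinarith [mul_nonneg hp.le hb]
  have k₂ : q * a ≤ q * e * a := by nlinarith [mul_nonneg hq.le ha]
  rcases le_total (p * e * b) (q * a) with h₁ | h₁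
  · refine ⟨(q * a - p * e * b) / q, b / q, 0, 0, div_nonneg (by linarith) hq.le, by positivity,
      le_rfl, le_rfl, by field_simp; ring, by field_simp; ring, ?_, ?_⟩
    · rw [max_eq_left (by linarith)]; field_simp
    · rw [max_eq_right (by linarith)]; ring
  rcases le_total (q * e * a) (p * b) with h₂ | h₂
  · refine ⟨0, 0, a / p, (p * b - q * e * a) / p, le_rfl, le_rfl, by positivity,
      div_nonneg (by linarith) hp.le, by field_simp; ring, by field_simp; ring, ?_, ?_⟩
    · rw [max_eq_right (by linarith)]; ring
    · rw [max_eq_left (by linarith)]; field_simp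
  -- Between the two kinks the column is expanded in the two inner directions, whose determinant is
  -- p q (e² - 1); for e = 1 they are parallel and one suffices.
  rcases he.eq_or_lt with h | h
  · subst h
    refine ⟨0, a / p, 0, 0, le_rfl, by positivity, le_rfl, le_rfl, by field_simp; ring, ?_, ?_, ?_⟩
    · have : q * a = p * b := by linarith
      field_simp; linarith
    · rw [max_eq_right (by linarith)]; ring
    · rw [max_eq_right (by linarith)]; ring
  · have h2 : 0 < e ^ 2 - 1 := by nlinarith
    refine ⟨0, (q * e * a - p * b) / (p * q * (e ^ 2 - 1)),
      (p * e * b - q * a) / (p * q * (e ^ 2 - 1)), 0, le_rfl,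
      div_nonneg (by linarith) (by positivity), div_nonneg (by linarith) (by positivity), le_rfl,
      ?_, ?_, ?_, ?_⟩
    · field_simp; ring
    · field_simp; ring
    · rw [max_eq_right (by linarith)]; ring
    · rw [max_eq_right (by linarith)]; ring

/-- A Blackwell-type criterion: a four-signal law with columns `(m₁, 0)`, `l (p e, q)`,
`k (p, q e)`, `(0, m₀)` dominates the law with columns `(a t, b t)` as soon as the two hinge
inequalities hold. -/
theorem exists_kernel_of_hinge_le {T : Type*} [Nonempty T] {p q e m₁ m₀ l k A B : ℝ} {a b : T → ℝ}
    (hp : 0 < p) (hq : 0 < q) (he : 1 ≤ e)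
    (ha : ∀ t, 0 ≤ a t) (hb : ∀ t, 0 ≤ b t) (hA : HasSum a A) (hB : HasSum b B)
    (hA' : m₁ + p * e * l + p * k = A) (hB' : m₀ + q * l + q * e * k = B)
    (h₁ : ∑' t, max (q * a t - p * e * b t) 0 ≤ q * m₁)
    (h₀ : ∑' t, max (p * b t - q * e * a t) 0 ≤ p * m₀) :
    ∃ K : Fin 4 → T → ℝ, (∀ i t, 0 ≤ K i t) ∧ (∀ i, HasSum (K i) 1) ∧
      (∀ t, K 0 t * m₁ + K 1 t * (p * e * l) + K 2 t * (p * k) = a t) ∧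
      (∀ t, K 1 t * (q * l) + K 2 t * (q * e * k) + K 3 t * m₀ = b t) := by
  have he0 : 0 < e := by linarith
  choose u g h d hu hg hh hd hua hdb hu1 hd1 using fun t =>
    exists_column_decomposition hp hq he (ha t) (hb t)
  have su : Summable u := hA.summable.of_nonneg_of_le hu fun t => by
    have := hua t; have := mul_nonneg (mul_nonneg hp.le he0.le) (hg t)
    have := mul_nonneg hp.le (hh t); linarith
  have sd : Summable d := hB.summable.of_nonneg_of_le hd fun t => by
    have := hdb t; have := mul_nonneg (mul_nonneg hq.le he0.le) (hh t)
    have := mul_nonneg hq.le (hg t); linarith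
  have sg : Summable g := (hB.summable.div_const q).of_nonneg_of_le hg fun t => by
    have := hdb t; have := mul_nonneg (mul_nonneg hq.le he0.le) (hh t)
    rw [le_div_iff₀ hq]; have := hd t; linarith
  have sh : Summable h := (hA.summable.div_const p).of_nonneg_of_le hh fun t => by
    have := hua t; have := mul_nonneg (mul_nonneg hp.le he0.le) (hg t)
    rw [le_div_iff₀ hp]; have := hu t; linarith
  obtain ⟨U, hU⟩ := su
  obtain ⟨D, hD⟩ := sd
  obtain ⟨G, hG⟩ := sg
  obtain ⟨H, hH⟩ := sh
  have eA : U + p * e * G + p * H = A :=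
    (((hU.add (hG.mul_left (p * e))).add (hH.mul_left p)).congr_fun fun t => (hua t).symm).unique hA
  have eB : D + q * G + q * e * H = B :=
    (((hD.add (hG.mul_left q)).add (hH.mul_left (q * e))).congr_fun fun t => (hdb t).symm).unique hB
  have hUm : U ≤ m₁ := by
    have : ∑' t, max (q * a t - p * e * b t) 0 = q * U := by
      rw [← (hU.mul_left q).tsum_eq]; exact tsum_congr fun t => (hu1 t).symm
    rw [this] at h₁; exact le_of_mul_le_mul_left h₁ hq
  have hDm : D ≤ m₀ := by
    have : ∑' t, max (p * b t - q * e * a t) 0 = p * D := by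
      rw [← (hD.mul_left p).tsum_eq]; exact tsum_congr fun t => (hd1 t).symm
    rw [this] at h₀; exact le_of_mul_le_mul_left h₀ hp
  obtain ⟨α, β, γ, δ, ⟨hα0, hα1⟩, ⟨hβ0, hβ1⟩, ⟨hγ0, hγ1⟩, ⟨hδ0, hδ1⟩, r₁, r₂⟩ :=
    exists_two_target_split (c₁ := p * e) (d₁ := q) (c₂ := p) (d₂ := q * e) (x := m₁ - U)
      (y := m₀ - D) (m₁ := l) (m₂ := k) (n₁ := G) (n₂ := H) (by positivity) hq.le hp.le
      (by positivity) (hG.nonneg hg) (hH.nonneg hh) (by linarith) (by linarith)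
  obtain ⟨ρ, hρ0, hρ1, hρ⟩ := exists_unit_mul_eq (hU.nonneg hu) hUm
  obtain ⟨σ, hσ0, hσ1, hσ⟩ := exists_unit_mul_eq (hD.nonneg hd) hDm
  obtain ⟨u', hu', su', eu⟩ := exists_normalization hu hU
  obtain ⟨d', hd', sd', ed⟩ := exists_normalization hd hD
  obtain ⟨g', hg', sg', eg⟩ := exists_normalization hg hG
  obtain ⟨h', hh', sh', eh⟩ := exists_normalization hh hH
  have mixn : ∀ {r : ℝ} {f₁ f₂ : T → ℝ}, 0 ≤ r → r ≤ 1 → (∀ t, 0 ≤ f₁ t) → (∀ t, 0 ≤ f₂ t) →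
      ∀ t, 0 ≤ r * f₁ t + (1 - r) * f₂ t := fun h0 h1 p₁ p₂ t =>
    add_nonneg (mul_nonneg h0 (p₁ t)) (mul_nonneg (by linarith) (p₂ t))
  have mixs : ∀ (r : ℝ) {f₁ f₂ : T → ℝ}, HasSum f₁ 1 → HasSum f₂ 1 →
      HasSum (fun t => r * f₁ t + (1 - r) * f₂ t) 1 := fun r f₁ f₂ s₁ s₂ => by
    simpa using (s₁.mul_left r).add (s₂.mul_left (1 - r))
  -- The pure signals first cover the pure parts U, D of the targets, with ρ m₁ = U and σ m₀ = D.
  -- Their surplus and the two kink columns are shared between the totals G and H by the split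
  -- above, and each total is spread over the targets by its normalized profile.
  refine ⟨![fun t => ρ * u' t + (1 - ρ) * (α * g' t + (1 - α) * h' t),
    fun t => β * g' t + (1 - β) * h' t, fun t => γ * g' t + (1 - γ) * h' t,
    fun t => σ * d' t + (1 - σ) * (δ * g' t + (1 - δ) * h' t)], ?_, ?_, ?_, ?_⟩
  · intro i
    fin_cases i
    · exact mixn hρ0 hρ1 hu' (mixn hα0 hα1 hg' hh')
    · exact mixn hβ0 hβ1 hg' hh'
    · exact mixn hγ0 hγ1 hg' hh'
    · exact mixn hσ0 hσ1 hd' (mixn hδ0 hδ1 hg' hh')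
  · intro i
    fin_cases i
    · exact mixs ρ su' (mixs α sg' sh')
    · exact mixs β sg' sh'
    · exact mixs γ sg' sh'
    · exact mixs σ sd' (mixs δ sg' sh')
  · intro t
    simp only [Matrix.cons_val]
    rw [← hua t, ← eu t, ← eg t, ← eh t]
    linear_combination (u' t - α * g' t - (1 - α) * h' t) * hρ + (g' t - h' t) * r₁
      + h' t * (hA' - eA)
  · intro t
    simp only [Matrix.cons_val]
    rw [← hdb t, ← ed t, ← eg t, ← eh t]
    linear_combination (d' t - δ * g' t - (1 - δ) * h' t) * hσ + (g' t - h' t) * r₂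
      + h' t * (hB' - eB)

/-! ### Choice of the widths. -/

/-- The widths of `t₂` and `t₃` in the optimal structure, with complementary slackness. -/
theorem exists_optimal_widths {e x y : ℝ} (he : 1 ≤ e) (hy : 0 ≤ y) (hyx : y ≤ x) (hx : x ≤ 1) :
    ∃ l k : ℝ, 0 ≤ l ∧ 0 ≤ k ∧
      (e⁻¹ * y ≤ x - e * l - k ∧ x - e * l - k ≤ e * y) ∧
      (e⁻¹ * (1 - x) ≤ 1 - y - l - e * k ∧ 1 - y - l - e * k ≤ e * (1 - x)) ∧
      (x - e * l - k = e * y ∨ l = 0) ∧ (1 - y - l - e * k = e * (1 - x) ∨ k = 0) ∧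
      (x ≤ e * y ∧ 1 - y ≤ e * (1 - x) → l = 0 ∧ e * k = 0) ∧
      ((x ≤ e * y ∧ e * (1 - x) < 1 - y) ∨
        (e * y < x ∧ e * (1 - x) < 1 - y ∧ 1 / (1 + e) ≤ y) →
        l = 0 ∧ e * k = 1 - y - e * (1 - x)) ∧
      ((e * y < x ∧ 1 - y ≤ e * (1 - x)) ∨
        (e * y < x ∧ e * (1 - x) < 1 - y ∧ x ≤ 1 / (1 + e⁻¹)) →
        l = e⁻¹ * x - y ∧ e * k = 0) ∧
      (e * y < x ∧ e * (1 - x) < 1 - y ∧ 1 / (1 + e⁻¹) < x ∧ y < 1 / (1 + e) →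
        l = 1 / (e + 1) - y ∧ e * k = e * x - e ^ 2 / (e + 1)) := by
  have he0 : 0 < e := by linarith
  have hi : e⁻¹ * e = 1 := inv_mul_cancel₀ he0.ne'
  have hi0 : 0 < e⁻¹ := inv_pos.2 he0
  have hi1 : e⁻¹ ≤ 1 := inv_le_one_of_one_le₀ he
  have w : 1 / (1 + e⁻¹) = e / (1 + e) := by field_simp; ring
  rw [w]
  have q₁ : ∀ z : ℝ, 1 / (1 + e) ≤ z ↔ 1 ≤ z * (1 + e) := fun z => div_le_iff₀ (by positivity)
  have q₂ : ∀ z : ℝ, z ≤ e / (1 + e) ↔ z * (1 + e) ≤ e := fun z => le_div_iff₀ (by positivity)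
  have q₃ : ∀ z : ℝ, z < 1 / (1 + e) ↔ z * (1 + e) < 1 := fun z => lt_div_iff₀ (by positivity)
  have q₄ : ∀ z : ℝ, e / (1 + e) < z ↔ e < z * (1 + e) := fun z => div_lt_iff₀ (by positivity)
  simp only [q₁, q₂, q₃, q₄]
  have n₁ : e⁻¹ * y ≤ y := by nlinarith
  have n₂ : e⁻¹ * (1 - x) ≤ 1 - x := by nlinarith
  have n₃ : y ≤ e * y := by nlinarith
  have n₄ : 1 - x ≤ e * (1 - x) := by nlinarith
  by_cases c₁ : x ≤ e * y <;> by_cases c₂ : 1 - y ≤ e * (1 - x)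
  · refine ⟨0, 0, le_rfl, le_rfl, ?_, ?_, by simp, by simp, by simp, ?_, ?_, ?_⟩
    · constructor <;> linarith
    · constructor <;> linarith
    · rintro (h | h) <;> linarith
    · rintro (h | h) <;> linarith
    · intro h; linarith
  all_goals try rw [not_le] at c₁
  all_goals try rw [not_le] at c₂
  -- Only t₃ is needed; its width is the one that makes the constraint on t₄ tight.
  · have hk : e * (e⁻¹ * (1 - y) - (1 - x)) = 1 - y - e * (1 - x) := by
      linear_combination (1 - y) * hi
    refine ⟨0, e⁻¹ * (1 - y) - (1 - x), le_rfl, ?_, ?_, ?_, by simp, ?_, ?_, ?_, ?_, ?_⟩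
    · nlinarith
    · constructor <;> nlinarith
    · constructor <;> linarith
    · left; linarith
    · intro h; linarith
    · intro; exact ⟨rfl, hk⟩
    · rintro (h | h) <;> linarith
    · intro h; linarith
  -- Symmetrically, only t₂ is needed, with the width that makes the constraint on t₁ tight.
  · have hl : e * (e⁻¹ * x - y) = x - e * y := by linear_combination x * hi
    refine ⟨e⁻¹ * x - y, 0, ?_, le_rfl, ?_, ?_, ?_, by simp, ?_, ?_, ?_, ?_⟩
    · nlinarith
    · constructor <;> linarith
    · constructor <;> nlinarith
    · left; linarith
    · intro h; linarith
    · rintro (h | h) <;> linarith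
    · intro; simp
    · intro h; linarith
  rcases le_or_gt 1 (y * (1 + e)) with c₃ | c₃
  · have hk : e * (e⁻¹ * (1 - y) - (1 - x)) = 1 - y - e * (1 - x) := by
      linear_combination (1 - y) * hi
    -- The left side is the remaining width x - k of t₁; the threshold on y is what keeps it within
    -- the privacy bound.
    have hu : 1 - e⁻¹ * (1 - y) ≤ e * y := by
      have : 0 ≤ (1 - e⁻¹) * (y * (1 + e) - 1) := mul_nonneg (by linarith) (by linarith)
      linarith [show (1 - e⁻¹) * (y * (1 + e) - 1) = e * y + e⁻¹ * (1 - y) - 1 by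
        linear_combination (-y) * hi]
    refine ⟨0, e⁻¹ * (1 - y) - (1 - x), le_rfl, ?_, ?_, ?_, by simp, ?_, ?_, ?_, ?_, ?_⟩
    · nlinarith
    · constructor <;> nlinarith
    · constructor <;> linarith
    · left; linarith
    · intro h; linarith
    · intro; exact ⟨rfl, hk⟩
    -- The two regions are disjoint: 1 ≤ y (1 + e) and e y < x force e < x (1 + e).
    · rintro (h | h) <;> nlinarith
    · intro h; linarith
  rcases le_or_gt (x * (1 + e)) e with c₄ | c₄
  · have hl : e * (e⁻¹ * x - y) = x - e * y := by linear_combination x * hi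
    have hu : 1 - e⁻¹ * x ≤ e * (1 - x) := by
      have : 0 ≤ (1 - e⁻¹) * (e - x * (1 + e)) := mul_nonneg (by linarith) (by linarith)
      linarith [show (1 - e⁻¹) * (e - x * (1 + e)) = e * (1 - x) - (1 - e⁻¹ * x) by
        linear_combination (x - 1) * hi]
    refine ⟨e⁻¹ * x - y, 0, ?_, le_rfl, ?_, ?_, ?_, by simp, ?_, ?_, ?_, ?_⟩
    · nlinarith
    · constructor <;> linarith
    · constructor <;> nlinarith
    · left; linarith
    · intro h; linarith
    · rintro (h | h) <;> linarith
    · intro; simp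
    · intro h; linarith
  -- Here both constraints are made tight; for e > 1 the resulting two linear equations in l and k
  -- have the single solution l = z - y, k = x - (1 - z), which still works for e = 1.
  · have h1 : 1 / (e + 1) * (1 + e) = 1 := by field_simp; ring
    have h2 : e ^ 2 / (e + 1) = e * (1 - 1 / (e + 1)) := by field_simp; ring
    set z := 1 / (e + 1) with hz
    have e₁ : x - e * (z - y) - (x - (1 - z)) = e * y := by linear_combination -h1
    have e₂ : 1 - y - (z - y) - e * (x - (1 - z)) = e * (1 - x) := by linear_combination -h1
    rw [h2]
    refine ⟨z - y, x - (1 - z), ?_⟩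
    rw [e₁, e₂]
    refine ⟨?_, ?_, ?_, ?_, by simp, by simp, ?_, ?_, ?_, ?_⟩
    · nlinarith
    · nlinarith
    · constructor <;> linarith
    · constructor <;> linarith
    · intro h; linarith
    · rintro (h | h) <;> linarith
    · rintro (h | h) <;> linarith
    · intro; exact ⟨rfl, by ring⟩

/-- The multiplied-out form stays correct at y = 0, where x / 0 is `⊤` for x > 0 and 0 / 0 = 0. -/
theorem ofReal_div_le_ofReal_iff {x y e : ℝ} (hx : 0 ≤ x) (hy : 0 ≤ y) (he : 0 ≤ e) :
    ENNReal.ofReal x / ENNReal.ofReal y ≤ ENNReal.ofReal e ↔ x ≤ e * y := by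
  rcases hy.eq_or_lt with rfl | hy
  · rcases hx.eq_or_lt with rfl | hx
    · simp
    · simp [ENNReal.div_zero (ENNReal.ofReal_pos.2 hx).ne', hx]
  · rw [← ENNReal.ofReal_div_of_pos hy, ENNReal.ofReal_le_ofReal_iff he, div_le_iff₀ hy]

/-! ### Probability masses as real numbers. -/

theorem ENNReal.hasSum_toReal_tsum {α : Type*} {f : α → ENNReal} (h : ∑' a, f a ≠ ⊤) :
    HasSum (fun a => (f a).toReal) (∑' a, f a).toReal := by
  rw [ENNReal.tsum_toReal_eq (ENNReal.ne_top_of_tsum_ne_top h)]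
  exact ENNReal.hasSum_toReal h

theorem PMF.toReal_apply_nonneg {α : Type*} (μ : PMF α) (a : α) : 0 ≤ (μ a).toReal :=
  ENNReal.toReal_nonneg

theorem PMF.ext_toReal {α : Type*} {μ ν : PMF α} (h : ∀ a, (μ a).toReal = (ν a).toReal) :
    μ = ν := by
  ext a
  exact (ENNReal.toReal_eq_toReal_iff' (μ.apply_ne_top a) (ν.apply_ne_top a)).1 (h a)

theorem PMF.hasSum_toReal {α : Type*} (μ : PMF α) : HasSum (fun a => (μ a).toReal) 1 := by
  have h := ENNReal.hasSum_toReal_tsum (μ.tsum_coe_ne_top)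
  rwa [μ.tsum_coe, ENNReal.toReal_one] at h

/-- A probability mass function from real weights. -/
noncomputable def PMF.ofReal {α : Type*} (f : α → ℝ) (h0 : ∀ a, 0 ≤ f a) (h1 : HasSum f 1) :
    PMF α :=
  ⟨fun a => ENNReal.ofReal (f a), by
    have h := (ENNReal.summable (f := fun a => ENNReal.ofReal (f a))).hasSum
    rwa [← ENNReal.ofReal_tsum_of_nonneg h0 h1.summable, h1.tsum_eq, ENNReal.ofReal_one] at h⟩

@[simp]
theorem PMF.ofReal_apply_toReal {α : Type*} (f : α → ℝ) (h0 : ∀ a, 0 ≤ f a) (h1 : HasSum f 1)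
    (a : α) : (PMF.ofReal f h0 h1 a).toReal = f a :=
  ENNReal.toReal_ofReal (h0 a)

/-- Mass functions of images, in terms of real sums. -/
theorem PMF.hasSum_map_toReal {α β : Type*} [DecidableEq β] (μ : PMF α) (f : α → β) (b : β) :
    HasSum (fun a => if b = f a then (μ a).toReal else 0) ((μ.map f b).toReal) := by
  classical
  have hle : ∀ a, (if b = f a then μ a else 0) ≤ μ a := fun a => by split_ifs <;> simp
  have hne : ∑' a, (if b = f a then μ a else 0) ≠ ⊤ :=
    ne_top_of_le_ne_top μ.tsum_coe_ne_top (ENNReal.tsum_le_tsum hle)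
  have h := ENNReal.hasSum_toReal_tsum hne
  rw [PMF.map_apply]
  convert h using 2 with a
  · split_ifs <;> simp
  · congr!

theorem priorS_eq (π : PMF (Fin 2 × Fin 2)) (s : Fin 2) :
    priorS π s = (π (s, 0)).toReal + (π (s, 1)).toReal := by
  simp [priorS]

theorem priorS_add (π : PMF (Fin 2 × Fin 2)) : priorS π 0 + priorS π 1 = 1 := by
  have h := (hasSum_fintype _).unique π.hasSum_toReal
  rw [Fintype.sum_prod_type] at h
  simpa [priorS] using h

theorem priorS_mul_qS {π : PMF (Fin 2 × Fin 2)} {s : Fin 2} (h : 0 < priorS π s) :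
    priorS π s * qS π s = (π (s, 1)).toReal :=
  mul_div_cancel₀ _ h.ne'

theorem priorS_mul_one_sub_qS {π : PMF (Fin 2 × Fin 2)} {s : Fin 2} (h : 0 < priorS π s) :
    priorS π s * (1 - qS π s) = (π (s, 0)).toReal := by
  rw [mul_sub, priorS_mul_qS h, priorS_eq]; ring

theorem qS_nonneg (π : PMF (Fin 2 × Fin 2)) (s : Fin 2) : 0 ≤ qS π s :=
  div_nonneg ENNReal.toReal_nonneg (sum_nonneg fun _ _ => ENNReal.toReal_nonneg)

theorem qS_le_one {π : PMF (Fin 2 × Fin 2)} {s : Fin 2} (h : 0 < priorS π s) : qS π s ≤ 1 := by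
  rw [qS, div_le_one h, priorS_eq]
  linarith [π.toReal_apply_nonneg (s, 0)]

/-! ### Masses, posteriors and Blackwell domination in real terms. -/

namespace InfoStructure

variable {π : PMF (Fin 2 × Fin 2)} {T T' : Type*}

theorem prob_nonneg (M : InfoStructure π T) (s y : Fin 2) (t : T) : 0 ≤ M.prob s y t :=
  ENNReal.toReal_nonneg

/-- `ℙ(Y = y, T = t)`. -/
noncomputable def probYT (M : InfoStructure π T) (y : Fin 2) (t : T) : ℝ :=
  ∑ s, M.prob s y t

theorem probYT_eq (M : InfoStructure π T) (y : Fin 2) (t : T) :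
    M.probYT y t = M.prob 0 y t + M.prob 1 y t := by
  simp [probYT]

theorem probYT_nonneg (M : InfoStructure π T) (y : Fin 2) (t : T) : 0 ≤ M.probYT y t :=
  sum_nonneg fun _ _ => M.prob_nonneg _ _ _

theorem probT_eq (M : InfoStructure π T) (t : T) : M.probT t = M.probYT 1 t + M.probYT 0 t := by
  simp [probT, probYT]; ring

theorem probT_nonneg (M : InfoStructure π T) (t : T) : 0 ≤ M.probT t :=
  sum_nonneg fun _ _ => sum_nonneg fun _ _ => M.prob_nonneg _ _ _

theorem postY_eq (M : InfoStructure π T) (t : T) : M.postY t = M.probYT 1 t / M.probT t := rfl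

theorem probT_mul_postY (M : InfoStructure π T) (t : T) :
    M.probT t * M.postY t = M.probYT 1 t := by
  rw [postY_eq]
  by_cases h : M.probT t = 0
  · have h1 := M.probYT_nonneg 1 t
    have h0 := M.probYT_nonneg 0 t
    have := M.probT_eq t
    rw [h]; linarith
  · exact mul_div_cancel₀ _ h

theorem probT_mul_one_sub_postY (M : InfoStructure π T) (t : T) :
    M.probT t * (1 - M.postY t) = M.probYT 0 t := by
  rw [mul_sub, probT_mul_postY, probT_eq]; ring

theorem postY_mem_Icc (M : InfoStructure π T) (t : T) : M.postY t ∈ Set.Icc (0 : ℝ) 1 := by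
  have h1 := M.probYT_nonneg 1 t
  have h0 := M.probYT_nonneg 0 t
  refine ⟨div_nonneg h1 (M.probT_nonneg t), div_le_one_of_le₀ ?_ (M.probT_nonneg t)⟩
  change M.probYT 1 t ≤ _
  rw [probT_eq]; linarith

theorem hasSum_prob (M : InfoStructure π T) (s y : Fin 2) :
    HasSum (M.prob s y) (π (s, y)).toReal := by
  classical
  have h := M.joint.hasSum_map_toReal (fun x => (x.1, x.2.1)) (s, y)
  rw [M.marginal] at h
  have hinj : Function.Injective (fun t : T => ((s, y, t) : Fin 2 × Fin 2 × T)) :=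
    fun t t' h => by simpa using h
  rw [← hinj.hasSum_iff] at h
  · convert h using 1
    ext t
    simp [prob]
  · rintro ⟨s', y', t⟩ hx
    rw [if_neg]
    rintro ⟨⟩
    exact hx ⟨t, rfl⟩

theorem hasSum_probYT (M : InfoStructure π T) (y : Fin 2) :
    HasSum (M.probYT y) ((π (0, y)).toReal + (π (1, y)).toReal) := by
  have h := (M.hasSum_prob 0 y).add (M.hasSum_prob 1 y)
  exact h.congr_fun fun t => M.probYT_eq y t

theorem hasSum_probT (M : InfoStructure π T) : HasSum M.probT 1 := by
  have h := (M.hasSum_probYT 1).add (M.hasSum_probYT 0)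
  have e : (π (0, 1)).toReal + (π (1, 1)).toReal + ((π (0, 0)).toReal + (π (1, 0)).toReal) = 1 := by
    have := priorS_add π
    rw [priorS_eq, priorS_eq] at this; linarith
  rw [e] at h
  exact h.congr_fun fun t => M.probT_eq t

theorem nonempty_signals (M : InfoStructure π T) : Nonempty T := by
  by_contra h
  rw [not_nonempty_iff] at h
  exact zero_ne_one (hasSum_empty.unique M.hasSum_probT)

theorem lawYT_apply_toReal (M : InfoStructure π T) (y : Fin 2) (t : T) :
    (M.lawYT (y, t)).toReal = M.probYT y t := by
  classical
  have h := M.joint.hasSum_map_toReal Prod.snd (y, t)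
  have hinj : Function.Injective (fun s : Fin 2 => ((s, y, t) : Fin 2 × Fin 2 × T)) :=
    fun s s' h => by simpa using h
  rw [← hinj.hasSum_iff] at h
  · rw [lawYT, probYT]
    refine h.unique ?_
    convert hasSum_fintype _ using 2
    simp [prob]
  · rintro ⟨s', y', t'⟩ hx
    rw [if_neg]
    rintro ⟨⟩
    exact hx ⟨s', rfl⟩

/-- Blackwell domination in terms of the real masses `ℙ(Y = y, T = t)`. -/
theorem hasSum_of_lawYT_eq {M : InfoStructure π T} {M' : InfoStructure π T'} {K : T → PMF T'}
    (h : M'.lawYT = M.lawYT.bind fun x => (K x.2).map (Prod.mk x.1)) (y : Fin 2) (t' : T') :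
    HasSum (fun t => M.probYT y t * (K t t').toReal) (M'.probYT y t') := by
  classical
  have e : M'.lawYT (y, t') = ∑' t, M.lawYT (y, t) * K t t' := by
    rw [h, PMF.bind_apply]
    have hinj : Function.Injective (fun t : T => ((y, t) : Fin 2 × T)) :=
      fun t t' h => by simpa using h
    rw [← hinj.tsum_eq]
    · refine tsum_congr fun t => ?_
      congr 1
      rw [PMF.map_apply, tsum_eq_single t']
      · simp
      · intro b hb
        rw [if_neg]
        rintro ⟨⟩
        exact hb rfl
    · rintro ⟨y', t⟩ hx
      by_contra hne
      apply hx
      have : y ≠ y' := by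
        rintro rfl
        exact hne ⟨t, rfl⟩
      simp [PMF.map_apply, this]
  have hne : ∑' t, M.lawYT (y, t) * K t t' ≠ ⊤ := e ▸ M'.lawYT.apply_ne_top _
  have := ENNReal.hasSum_toReal_tsum hne
  rw [← e, lawYT_apply_toReal] at this
  simpa [ENNReal.toReal_mul, lawYT_apply_toReal] using this

theorem dominates_of_sum [Fintype T] {M : InfoStructure π T} {M' : InfoStructure π T'}
    {k : T → T' → ℝ} (h0 : ∀ t t', 0 ≤ k t t') (h1 : ∀ t, HasSum (k t) 1)
    (h : ∀ y t', ∑ t, M.probYT y t * k t t' = M'.probYT y t') : M.Dominates M' := by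
  classical
  refine ⟨fun t => PMF.ofReal (k t) (h0 t) (h1 t), PMF.ext_toReal ?_⟩
  rintro ⟨y, t'⟩
  rw [lawYT_apply_toReal, ← h y t', PMF.bind_apply, ENNReal.tsum_toReal_eq]
  · rw [tsum_fintype, Fintype.sum_prod_type, Finset.sum_eq_single y]
    · refine sum_congr rfl fun t _ => ?_
      rw [ENNReal.toReal_mul, lawYT_apply_toReal, PMF.map_apply, tsum_eq_single t']
      · simp
      · intro b hb
        rw [if_neg]
        rintro ⟨⟩
        exact hb rfl
    · intro y' _ hy
      refine sum_eq_zero fun t _ => ?_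
      simp [PMF.map_apply, hy.symm]
    · simp
  · rintro ⟨y', t⟩
    exact ENNReal.mul_ne_top (PMF.apply_ne_top _ _) (PMF.apply_ne_top _ _)

end InfoStructure

/-! ### Convexity and hinge sums. -/

/-- A convex function on `[0, 1]` is bounded. -/
theorem ConvexOn.exists_abs_le {u : ℝ → ℝ} (hu : ConvexOn ℝ (Set.Icc 0 1) u) :
    ∃ C, ∀ x ∈ Set.Icc (0 : ℝ) 1, |u x| ≤ C := by
  have up : ∀ x ∈ Set.Icc (0 : ℝ) 1, u x ≤ |u 0| + |u 1| := by
    rintro x ⟨h0, h1⟩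
    have h := hu.2 (x := 0) (y := 1) (by simp) (by simp) (sub_nonneg.2 h1) h0 (by ring)
    simp only [smul_eq_mul, mul_zero, mul_one, zero_add] at h
    have e₁ := mul_le_mul_of_nonneg_left (le_abs_self (u 0)) (sub_nonneg.2 h1)
    have e₂ := mul_le_mul_of_nonneg_left (le_abs_self (u 1)) h0
    have e₃ := mul_nonneg h0 (abs_nonneg (u 0))
    have e₄ := mul_nonneg (sub_nonneg.2 h1) (abs_nonneg (u 1))
    linarith
  refine ⟨2 * |u (1 / 2)| + |u 0| + |u 1|, fun x hx => abs_le.2 ⟨?_, ?_⟩⟩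
  -- The midpoint of x and 1 - x is 1/2, so the upper bound at 1 - x gives a lower bound at x.
  · have hx' : 1 - x ∈ Set.Icc (0 : ℝ) 1 := ⟨by linarith [hx.2], by linarith [hx.1]⟩
    have h := hu.2 hx hx' (show (0 : ℝ) ≤ 1 / 2 by norm_num) (show (0 : ℝ) ≤ 1 / 2 by norm_num)
      (by norm_num)
    simp only [smul_eq_mul] at h
    rw [show 1 / 2 * x + 1 / 2 * (1 - x) = 1 / 2 by ring] at h
    linarith [up _ hx', neg_abs_le (u (1 / 2))]
  · linarith [up x hx, abs_nonneg (u (1 / 2))]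

theorem HasSum.apply_eq_of_forall_ne {T : Type*} {f g : T → ℝ} {A : ℝ} {x : T} (hf : HasSum f A)
    (hg : HasSum g A) (h : ∀ y, y ≠ x → f y = g y) : f x = g x := by
  have h1 := hf.sub hg
  rw [sub_self] at h1
  have h2 := hasSum_single (f := fun y => f y - g y) x fun y hy => sub_eq_zero.2 (h y hy)
  exact sub_eq_zero.1 (h2.unique h1)

/-- If the bound C equals q m₁, termwise comparison suffices. If l = 0 and C' = p m₀, the other
hinge helps: e max(q a - p e b, 0) ≤ q e a - p b + c' termwise, and the right side totals q e m₁. If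
l = k = 0, then m₁ is all of A and the trivial bound q a is enough. -/
theorem tsum_hinge_le {T : Type*} {p q e m₁ m₀ l k A B C C' : ℝ} {a b c c' : T → ℝ}
    (hp : 0 ≤ p) (hq : 0 ≤ q) (he : 1 ≤ e)
    (ha : ∀ t, 0 ≤ a t) (hb : ∀ t, 0 ≤ b t) (hA : HasSum a A) (hB : HasSum b B)
    (hA' : m₁ + p * e * l + p * k = A) (hB' : m₀ + q * l + q * e * k = B)
    (hc : ∀ t, max (q * a t - p * e * b t) 0 ≤ c t) (hC : HasSum c C)
    (hc' : ∀ t, max (p * b t - q * e * a t) 0 ≤ c' t) (hC' : HasSum c' C')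
    (h₁ : C = q * m₁ ∨ l = 0) (h₀ : C' = p * m₀ ∨ k = 0) :
    ∑' t, max (q * a t - p * e * b t) 0 ≤ q * m₁ := by
  have he0 : 0 < e := by linarith
  have s : Summable fun t => max (q * a t - p * e * b t) 0 :=
    hC.summable.of_nonneg_of_le (fun t => le_max_right _ _) hc
  rcases h₁ with h₁ | rfl
  · exact h₁ ▸ hasSum_le hc s.hasSum hC
  rcases h₀ with h₀ | rfl
  · have hs : HasSum (fun t => q * e * a t - p * b t + c' t) (q * e * A - p * B + C') :=
      ((hA.mul_left _).sub (hB.mul_left _)).add hC'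
    have h := hasSum_le (fun t => ?_) (s.hasSum.mul_left e) hs
    · refine le_of_mul_le_mul_left (h.trans_eq ?_) he0
      rw [h₀, ← hA', ← hB']; ring
    · have h1 := (le_max_left _ _).trans (hc' t)
      have h2 := (le_max_right _ _).trans (hc' t)
      rw [mul_max_of_nonneg _ _ he0.le, mul_zero]
      refine max_le ?_ (by linarith)
      have : p * b t ≤ p * b t * (e * e) :=
        le_mul_of_one_le_right (mul_nonneg hp (hb t)) (one_le_mul_of_one_le_of_one_le he he)
      linarith
  · have h := hasSum_le (fun t => ?_) s.hasSum (hA.mul_left q)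
    · rw [← hA'] at h; simpa using h
    · have := mul_nonneg (mul_nonneg hp he0.le) (hb t)
      exact max_le (by linarith) (mul_nonneg hq (ha t))

/-! ### Privacy as hinge bounds. -/

namespace InfoStructure

variable {π : PMF (Fin 2 × Fin 2)} {T T' : Type*} {ε : ℝ}

theorem isPrivate_iff (hS : ∀ s, 0 < priorS π s) (M : InfoStructure π T) (hε : 0 ≤ ε) :
    M.IsPrivate ε ↔ ∀ t,
      priorS π 1 * (M.prob 0 0 t + M.prob 0 1 t) ≤
        Real.exp ε * (priorS π 0 * (M.prob 1 0 t + M.prob 1 1 t)) ∧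
      priorS π 0 * (M.prob 1 0 t + M.prob 1 1 t) ≤
        Real.exp ε * (priorS π 1 * (M.prob 0 0 t + M.prob 0 1 t)) := by
  have he : 1 ≤ Real.exp ε := Real.one_le_exp hε
  have h0 := hS 0
  have h1 := hS 1
  have same : ∀ s t, M.width t s ≤ Real.exp ε * M.width t s := fun s t =>
    le_mul_of_one_le_left (div_nonneg (sum_nonneg fun _ _ => M.prob_nonneg _ _ _) (hS s).le) he
  have key : ∀ {x y : ℝ} {p q : ℝ}, 0 < p → 0 < q →
      (x / p ≤ Real.exp ε * (y / q) ↔ q * x ≤ Real.exp ε * (p * y)) := fun {x y p q} hp hq => by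
    rw [← mul_div_assoc, div_le_div_iff₀ hp hq, mul_comm x q, mul_assoc, mul_comm y p]
  constructor
  · intro h t
    have h₁ := h 0 1 t
    have h₂ := h 1 0 t
    simp only [width, Fin.sum_univ_two] at h₁ h₂
    exact ⟨(key h0 h1).1 h₁, (key h1 h0).1 h₂⟩
  · intro h s s' t
    fin_cases s <;> fin_cases s'
    · exact same 0 t
    · simpa [width] using (key h0 h1).2 (h t).1
    · simpa [width] using (key h1 h0).2 (h t).2
    · exact same 1 t

/-- This is a rearrangement of one privacy inequality. Keeping the negative term is essential for
uniqueness: at the kink it forces the (s₀, 0) cell to vanish once the (s₁, 1) cell does. -/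
theorem IsPrivate.hinge_one {M : InfoStructure π T} (hM : M.IsPrivate ε)
    (hS : ∀ s, 0 < priorS π s) (hε : 0 ≤ ε) (t : T) :
    priorS π 1 * M.probYT 1 t - priorS π 0 * Real.exp ε * M.probYT 0 t ≤
      (priorS π 1 + priorS π 0 * Real.exp ε) * (M.prob 1 1 t - M.prob 0 0 t) := by
  have h := ((isPrivate_iff hS M hε).1 hM t).1
  rw [probYT_eq, probYT_eq]
  linarith

theorem IsPrivate.hinge_zero {M : InfoStructure π T} (hM : M.IsPrivate ε)
    (hS : ∀ s, 0 < priorS π s) (hε : 0 ≤ ε) (t : T) :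
    priorS π 0 * M.probYT 0 t - priorS π 1 * Real.exp ε * M.probYT 1 t ≤
      (priorS π 0 + priorS π 1 * Real.exp ε) * (M.prob 0 0 t - M.prob 1 1 t) := by
  have h := ((isPrivate_iff hS M hε).1 hM t).2
  rw [probYT_eq, probYT_eq]
  linarith

theorem IsPrivate.max_hinge_one_le {M : InfoStructure π T} (hM : M.IsPrivate ε)
    (hS : ∀ s, 0 < priorS π s) (hε : 0 ≤ ε) (t : T) :
    max (priorS π 1 * M.probYT 1 t - priorS π 0 * Real.exp ε * M.probYT 0 t) 0 ≤
      (priorS π 1 + priorS π 0 * Real.exp ε) * M.prob 1 1 t := by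
  have h := hM.hinge_one hS hε t
  have hc : 0 ≤ priorS π 1 + priorS π 0 * Real.exp ε :=
    add_nonneg (hS 1).le (mul_nonneg (hS 0).le (Real.exp_pos ε).le)
  have := mul_nonneg hc (M.prob_nonneg 0 0 t)
  exact max_le (by linarith) (mul_nonneg hc (M.prob_nonneg 1 1 t))

theorem IsPrivate.max_hinge_zero_le {M : InfoStructure π T} (hM : M.IsPrivate ε)
    (hS : ∀ s, 0 < priorS π s) (hε : 0 ≤ ε) (t : T) :
    max (priorS π 0 * M.probYT 0 t - priorS π 1 * Real.exp ε * M.probYT 1 t) 0 ≤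
      (priorS π 0 + priorS π 1 * Real.exp ε) * M.prob 0 0 t := by
  have h := hM.hinge_zero hS hε t
  have hc : 0 ≤ priorS π 0 + priorS π 1 * Real.exp ε :=
    add_nonneg (hS 0).le (mul_nonneg (hS 1).le (Real.exp_pos ε).le)
  have := mul_nonneg hc (M.prob_nonneg 1 1 t)
  exact max_le (by linarith) (mul_nonneg hc (M.prob_nonneg 0 0 t))

/-! ### Jensen's inequality and its equality case. -/

/-- Jensen's inequality for a garbling of a structure with finitely many signals. -/
theorem summable_and_expectedUtility_le_of_kernel [Fintype T] {M : InfoStructure π T}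
    {M' : InfoStructure π T'} {k : T → T' → ℝ} (h0 : ∀ t t', 0 ≤ k t t')
    (h1 : ∀ t, HasSum (k t) 1) (h : ∀ y t', ∑ t, M.probYT y t * k t t' = M'.probYT y t')
    {u : ℝ → ℝ} (hu : ConvexOn ℝ (Set.Icc 0 1) u) :
    Summable (fun t => M'.probT t * u (M'.postY t)) ∧
      M'.expectedUtility u ≤ M.expectedUtility u := by
  have hs : Summable (fun t => M'.probT t * u (M'.postY t)) := by
    obtain ⟨C, hC⟩ := hu.exists_abs_le
    refine Summable.of_norm_bounded (M'.hasSum_probT.summable.mul_right C) fun t => ?_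
    rw [Real.norm_eq_abs, abs_mul, abs_of_nonneg (M'.probT_nonneg t)]
    exact mul_le_mul_of_nonneg_left (hC _ (M'.postY_mem_Icc t)) (M'.probT_nonneg t)
  refine ⟨hs, ?_⟩
  have hP : ∀ t', ∑ t, M.probT t * k t t' = M'.probT t' := fun t' => by
    rw [M'.probT_eq, ← h, ← h, ← sum_add_distrib]
    exact sum_congr rfl fun t _ => by rw [M.probT_eq]; ring
  have hR : HasSum (fun t' => ∑ t, M.probT t * u (M.postY t) * k t t')
      (∑ t, M.probT t * u (M.postY t)) := by
    refine hasSum_sum fun t _ => ?_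
    simpa using (h1 t).mul_left (M.probT t * u (M.postY t))
  rw [expectedUtility, expectedUtility, tsum_fintype (fun t => M.probT t * u (M.postY t))]
  refine hasSum_le (fun t' => ?_) hs.hasSum hR
  have hJ : ∀ t, 0 ≤ M.probT t * k t t' := fun t => mul_nonneg (M.probT_nonneg t) (h0 t t')
  rcases (M'.probT_nonneg t').eq_or_lt with hz | hz
  · rw [← hz, zero_mul]
    have hz' := (sum_eq_zero_iff_of_nonneg fun t _ => hJ t).1 ((hP t').trans hz.symm)
    exact (sum_eq_zero fun t ht => by rw [mul_right_comm, hz' t ht, zero_mul]).ge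
  · have hj := hu.map_sum_le (t := univ) (w := fun t => M.probT t * k t t' / M'.probT t')
      (p := M.postY) (fun t _ => div_nonneg (hJ t) hz.le)
      (by rw [← sum_div, hP, div_self hz.ne']) (fun t _ => M.postY_mem_Icc t)
    have e : ∑ t, (M.probT t * k t t' / M'.probT t') • M.postY t = M'.postY t' := by
      rw [postY_eq, ← h 1 t', sum_div]
      exact sum_congr rfl fun t _ => by rw [← M.probT_mul_postY t, smul_eq_mul]; ring
    rw [e] at hj
    calc _ ≤ M'.probT t' * _ := mul_le_mul_of_nonneg_left hj hz.le
      _ = _ := by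
        rw [mul_sum]
        exact sum_congr rfl fun t _ => by rw [smul_eq_mul]; field_simp

/-- `M` and `M'` have the same law of the posterior `ℙ(Y = 1 | T)`, where `M'` has finitely many
signals. -/
def SamePosteriorLaw [Fintype T'] (M : InfoStructure π T) (M' : InfoStructure π T') : Prop :=
  ∀ φ : ℝ → ℝ, HasSum (fun t => M.probT t * φ (M.postY t)) (∑ i, M'.probT i * φ (M'.postY i))

/-- Under the coupling by the garbling kernel the posteriors form a martingale, so the mean squared
difference of the two posteriors is the difference of their second moments. If that is not positive,
the kernel joins only signals with equal posteriors. -/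
theorem Dominates.samePosteriorLaw [Fintype T'] {M : InfoStructure π T} {M' : InfoStructure π T'}
    (hd : M.Dominates M') (hs : Summable fun t => M.probT t * M.postY t ^ 2)
    (hle : ∑' t, M.probT t * M.postY t ^ 2 ≤ ∑ i, M'.probT i * M'.postY i ^ 2) :
    M.SamePosteriorLaw M' := by
  obtain ⟨K, hK⟩ := hd
  have hY := hasSum_of_lawYT_eq hK
  have hJ : ∀ i, HasSum (fun t => M.probT t * (K t i).toReal) (M'.probT i) := fun i => by
    rw [M'.probT_eq]
    exact ((hY 1 i).add (hY 0 i)).congr_fun fun t => by rw [M.probT_eq]; ring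
  have hK1 : ∀ t, ∑ i, (K t i).toReal = 1 := fun t =>
    (hasSum_fintype _).unique (K t).hasSum_toReal
  have hJ0 : ∀ t i, 0 ≤ M.probT t * (K t i).toReal := fun t i =>
    mul_nonneg (M.probT_nonneg t) ENNReal.toReal_nonneg
  have hJ1 : ∀ t, ∑ i, M.probT t * (K t i).toReal = M.probT t := fun t => by
    rw [← mul_sum, hK1, mul_one]
  have hD0 : ∀ t, 0 ≤ ∑ i, M.probT t * (K t i).toReal * (M.postY t - M'.postY i) ^ 2 :=
    fun t => sum_nonneg fun i _ => mul_nonneg (hJ0 t i) (sq_nonneg _)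
  have hD : HasSum (fun t => ∑ i, M.probT t * (K t i).toReal * (M.postY t - M'.postY i) ^ 2)
      (∑' t, M.probT t * M.postY t ^ 2 - ∑ i, M'.probT i * M'.postY i ^ 2) := by
    have h2 : HasSum (fun t => ∑ i, (M.probT t * (K t i).toReal * M'.postY i ^ 2 -
        2 * M'.postY i * (M.probYT 1 t * (K t i).toReal)))
        (∑ i, (M'.probT i * M'.postY i ^ 2 - 2 * M'.postY i * M'.probYT 1 i)) :=
      hasSum_sum fun i _ => ((hJ i).mul_right _).sub ((hY 1 i).mul_left _)
    have h3 := hs.hasSum.add h2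
    have e : ∑ i, (M'.probT i * M'.postY i ^ 2 - 2 * M'.postY i * M'.probYT 1 i) =
        -∑ i, M'.probT i * M'.postY i ^ 2 := by
      rw [← sum_neg_distrib]
      exact sum_congr rfl fun i _ => by rw [← M'.probT_mul_postY]; ring
    rw [e, ← sub_eq_add_neg] at h3
    refine h3.congr_fun fun t => ?_
    rw [← hJ1 t, sum_mul, ← sum_add_distrib, hJ1]
    exact sum_congr rfl fun i _ => by rw [← M.probT_mul_postY]; ring
  have hz : ∑' t, M.probT t * M.postY t ^ 2 - ∑ i, M'.probT i * M'.postY i ^ 2 = 0 :=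
    le_antisymm (by linarith) (hD.nonneg hD0)
  rw [hz, hasSum_zero_iff_of_nonneg hD0] at hD
  have hD' : ∀ t i, M.probT t * (K t i).toReal = 0 ∨ M.postY t = M'.postY i := fun t i => by
    have := (sum_eq_zero_iff_of_nonneg fun i _ => mul_nonneg (hJ0 t i) (sq_nonneg _)).1
      (congrFun hD t) i (mem_univ i)
    rcases mul_eq_zero.1 this with h | h
    · exact Or.inl h
    · exact Or.inr (sub_eq_zero.1 (pow_eq_zero_iff two_ne_zero |>.1 h))
  intro φ
  refine (hasSum_sum fun i _ => (hJ i).mul_right (φ (M'.postY i))).congr_fun fun t => ?_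
  nth_rw 1 [← hJ1 t]
  rw [sum_mul]
  refine sum_congr rfl fun i _ => ?_
  rcases hD' t i with h | h
  · rw [h, zero_mul, zero_mul]
  · rw [h]

/-! ### Merging all signals with equal posterior. -/

/-- Signals renamed by their posterior `ℙ(Y = 1 | T)`. -/
noncomputable def byPosterior (M : InfoStructure π T) : InfoStructure π ℝ where
  joint := M.joint.map fun x => (x.1, x.2.1, M.postY x.2.2)
  marginal := by
    rw [PMF.map_comp]
    exact M.marginal

open Classical in
theorem hasSum_prob_byPosterior (M : InfoStructure π T) (s y : Fin 2) (x : ℝ) :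
    HasSum (fun t => if x = M.postY t then M.prob s y t else 0) (M.byPosterior.prob s y x) := by
  have h := M.joint.hasSum_map_toReal (fun z => (z.1, z.2.1, M.postY z.2.2)) (s, y, x)
  have hinj : Function.Injective (fun t : T => ((s, y, t) : Fin 2 × Fin 2 × T)) :=
    fun t t' h => by simpa using h
  rw [← hinj.hasSum_iff] at h
  · refine h.congr_fun fun t => ?_
    simp [prob]
  · rintro ⟨s', y', t⟩ hx
    rw [if_neg]
    rintro ⟨⟩
    exact hx ⟨t, rfl⟩

open Classical in
theorem hasSum_probT_byPosterior (M : InfoStructure π T) (x : ℝ) :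
    HasSum (fun t => if x = M.postY t then M.probT t else 0) (M.byPosterior.probT x) := by
  have h : HasSum _ (M.byPosterior.probT x) := hasSum_sum fun s _ => hasSum_sum fun y _ =>
    M.hasSum_prob_byPosterior s y x
  refine h.congr_fun fun t => ?_
  split_ifs <;> simp [probT]

theorem postY_byPosterior (M : InfoStructure π T) {t : T} (ht : M.probT t ≠ 0) :
    M.byPosterior.postY (M.postY t) = M.postY t := by
  classical
  have hP := M.hasSum_probT_byPosterior (M.postY t)
  have hpos : 0 < M.byPosterior.probT (M.postY t) := by
    have := le_hasSum hP t fun t' _ => by split_ifs <;> simp [probT_nonneg]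
    rw [if_pos rfl] at this
    exact ((M.probT_nonneg t).lt_of_ne' ht).trans_le this
  rw [postY_eq, div_eq_iff hpos.ne', mul_comm]
  have h1 : HasSum _ (M.byPosterior.probYT 1 (M.postY t)) := hasSum_sum fun s _ =>
    M.hasSum_prob_byPosterior s 1 (M.postY t)
  refine h1.unique ((hP.mul_right (M.postY t)).congr_fun fun t' => ?_)
  split_ifs with h
  · rw [h, probT_mul_postY, probYT]
  · simp

theorem prob_byPosterior_of_shape (M : InfoStructure π T) {x : ℝ} {c : Fin 2 → Fin 2 → ℝ}
    (h : ∀ t, M.postY t = x → ∀ s y, M.prob s y t = c s y * M.probT t) (s y : Fin 2) :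
    M.byPosterior.prob s y x = c s y * M.byPosterior.probT x := by
  classical
  refine (M.hasSum_prob_byPosterior s y x).unique
    (((M.hasSum_probT_byPosterior x).mul_left (c s y)).congr_fun fun t => ?_)
  split_ifs with hx
  · exact h t hx.symm s y
  · simp

/-- Outside `E` the conditional law of (S, Y) is a function c of the posterior alone, so a weighted
average over signals with that posterior has the same shape. -/
theorem mergesTo_byPosterior (M : InfoStructure π T) {E : Set ℝ}
    (h : ∀ x ∉ E, ∃ c : Fin 2 → Fin 2 → ℝ, ∀ t, M.postY t = x →
      ∀ s y, M.prob s y t = c s y * M.probT t) : M.MergesTo E M.byPosterior := by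
  classical
  refine ⟨M.postY, rfl, fun t ht => ⟨(M.postY_byPosterior ht).symm, fun hx s y => ?_⟩⟩
  obtain ⟨c, hc⟩ := h _ hx
  have hpos : 0 < M.byPosterior.probT (M.postY t) := by
    have := le_hasSum (M.hasSum_probT_byPosterior (M.postY t)) t
      fun t' _ => by split_ifs <;> simp [probT_nonneg]
    rw [if_pos rfl] at this
    exact ((M.probT_nonneg t).lt_of_ne' ht).trans_le this
  rw [postSY, postSY, M.prob_byPosterior_of_shape hc, hc t rfl, mul_div_cancel_right₀ _ ht,
    mul_div_cancel_right₀ _ hpos.ne']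

theorem SamePosteriorLaw.probT_byPosterior [Fintype T'] {M : InfoStructure π T}
    {M' : InfoStructure π T'} (h : M.SamePosteriorLaw M') (x : ℝ) :
    M.byPosterior.probT x = M'.byPosterior.probT x := by
  classical
  have h' := h fun z => if x = z then 1 else 0
  refine (M.hasSum_probT_byPosterior x).unique ?_
  have e := (hasSum_fintype _).unique (M'.hasSum_probT_byPosterior x)
  simp only [mul_ite, mul_one, mul_zero] at h'
  rwa [e] at h'

theorem prob_one_byPosterior_zero (M : InfoStructure π T) (s : Fin 2) :
    M.byPosterior.prob s 1 0 = 0 := by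
  classical
  refine (M.hasSum_prob_byPosterior s 1 0).unique (hasSum_zero.congr_fun fun t => ?_)
  split_ifs with hx
  · have := M.probT_mul_postY t
    rw [← hx, mul_zero] at this
    exact (sum_eq_zero_iff_of_nonneg fun s _ => M.prob_nonneg s 1 t).1 this.symm s (mem_univ s)
  · rfl

theorem prob_zero_byPosterior_one (M : InfoStructure π T) (s : Fin 2) :
    M.byPosterior.prob s 0 1 = 0 := by
  classical
  refine (M.hasSum_prob_byPosterior s 0 1).unique (hasSum_zero.congr_fun fun t => ?_)
  split_ifs with hx
  · have := M.probT_mul_one_sub_postY t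
    rw [← hx, sub_self, mul_zero] at this
    exact (sum_eq_zero_iff_of_nonneg fun s _ => M.prob_nonneg s 0 t).1 this.symm s (mem_univ s)
  · rfl

/-- Posterior laws agreeing, the joint laws of `(S, Y)` and the posterior agree as soon as they
have common shapes at all posteriors other than `0` and `1`. -/
theorem SamePosteriorLaw.byPosterior_eq [Fintype T'] {M : InfoStructure π T}
    {M' : InfoStructure π T'} (h : M.SamePosteriorLaw M')
    (hc : ∀ x, x ≠ 0 → x ≠ 1 → ∃ c : Fin 2 → Fin 2 → ℝ,
      (∀ t, M.postY t = x → ∀ s y, M.prob s y t = c s y * M.probT t) ∧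
      (∀ t, M'.postY t = x → ∀ s y, M'.prob s y t = c s y * M'.probT t)) :
    M.byPosterior = M'.byPosterior := by
  have inner : ∀ x, x ≠ 0 → x ≠ 1 → ∀ s y,
      M.byPosterior.prob s y x = M'.byPosterior.prob s y x := by
    intro x h0 h1 s y
    obtain ⟨c, c1, c2⟩ := hc x h0 h1
    rw [M.prob_byPosterior_of_shape c1, M'.prob_byPosterior_of_shape c2, h.probT_byPosterior]
  have at_zero : ∀ s, M.byPosterior.prob s 1 0 = M'.byPosterior.prob s 1 0 := fun s => by
    rw [prob_one_byPosterior_zero, prob_one_byPosterior_zero]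
  have at_one : ∀ s, M.byPosterior.prob s 0 1 = M'.byPosterior.prob s 0 1 := fun s => by
    rw [prob_zero_byPosterior_one, prob_zero_byPosterior_one]
  have all : ∀ s y x, M.byPosterior.prob s y x = M'.byPosterior.prob s y x := by
    intro s y x
    fin_cases y
    · by_cases h0 : x = 0
      · subst h0
        -- No common shape is available at a revealing posterior, but its mass is what the other
        -- posteriors leave of the fixed prior mass of (s, y).
        refine (M.byPosterior.hasSum_prob s 0).apply_eq_of_forall_ne
          (M'.byPosterior.hasSum_prob s 0) fun x h0 => ?_
        by_cases h1 : x = 1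
        · rw [h1]; exact at_one s
        · exact inner x h0 h1 s 0
      by_cases h1 : x = 1
      · rw [h1]; exact at_one s
      · exact inner x h0 h1 s 0
    · by_cases h1 : x = 1
      · subst h1
        refine (M.byPosterior.hasSum_prob s 1).apply_eq_of_forall_ne
          (M'.byPosterior.hasSum_prob s 1) fun x h1 => ?_
        by_cases h0 : x = 0
        · rw [h0]; exact at_zero s
        · exact inner x h0 h1 s 1
      by_cases h0 : x = 0
      · rw [h0]; exact at_zero s
      · exact inner x h0 h1 s 1
  have hj : M.byPosterior.joint = M'.byPosterior.joint :=
    PMF.ext_toReal fun ⟨s, y, x⟩ => all s y x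
  cases hM : M.byPosterior
  cases hM' : M'.byPosterior
  simp_all

end InfoStructure

/-- By homogeneity a hinge of the masses is the signal's probability times a function of its
posterior; its total therefore depends on the posterior law only. -/
theorem InfoStructure.probT_mul_max {π : PMF (Fin 2 × Fin 2)} {T : Type*} (M : InfoStructure π T)
    (r s : ℝ) (t : T) : M.probT t * max (r * M.postY t - s * (1 - M.postY t)) 0 =
      max (r * M.probYT 1 t - s * M.probYT 0 t) 0 := by
  rw [mul_max_of_nonneg _ _ (M.probT_nonneg t), ← M.probT_mul_postY, ← M.probT_mul_one_sub_postY]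
  congr 1 <;> ring

/-! ### Signalwise consequences of equal posterior laws. -/

namespace InfoStructure.SamePosteriorLaw

variable {π : PMF (Fin 2 × Fin 2)} {T T' : Type*} [Fintype T'] {M : InfoStructure π T}
  {M' : InfoStructure π T'}

theorem exists_postY_eq (h : M.SamePosteriorLaw M') {t : T} (ht : M.probT t ≠ 0) :
    ∃ i, M'.probT i ≠ 0 ∧ M'.postY i = M.postY t := by
  classical
  have hs := h fun x => if x = M.postY t then 1 else 0
  have hle := le_hasSum hs t fun t' _ =>
    mul_nonneg (M.probT_nonneg t') (by split_ifs <;> norm_num)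
  rw [if_pos rfl, mul_one] at hle
  obtain ⟨i, -, hi⟩ := exists_ne_zero_of_sum_ne_zero
    (((M.probT_nonneg t).lt_of_ne' ht).trans_le hle).ne'
  refine ⟨i, left_ne_zero_of_mul hi, ?_⟩
  by_contra hne
  exact hi (by rw [if_neg hne, mul_zero])

/-- A pointwise upper bound on a hinge function of `(ℙ(Y = 1, T), ℙ(Y = 0, T))` whose total is the
expectation of that function is attained everywhere. -/
theorem max_eq (h : M.SamePosteriorLaw M') {r s : ℝ} {f : T → ℝ}
    (hf : ∀ t, max (r * M.probYT 1 t - s * M.probYT 0 t) 0 ≤ f t)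
    (hs : HasSum f (∑ i, max (r * M'.probYT 1 i - s * M'.probYT 0 i) 0)) (t : T) :
    max (r * M.probYT 1 t - s * M.probYT 0 t) 0 = f t := by
  have hm := h fun x => max (r * x - s * (1 - x)) 0
  simp only [probT_mul_max] at hm
  have hd := hs.sub hm
  rw [sub_self, hasSum_zero_iff_of_nonneg fun t => sub_nonneg.2 (hf t)] at hd
  exact (sub_eq_zero.1 (congrFun hd t)).symm

end InfoStructure.SamePosteriorLaw

/-! ### The four-signal structure dominates every private structure. -/

namespace HasWidths

variable {π : PMF (Fin 2 × Fin 2)} {T : Type*} {ε : ℝ} {l : Fin 4 → Fin 2 → ℝ}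
  {M : InfoStructure π (Fin 4)}

theorem sum_prob (h : HasWidths M l) (hS : ∀ s, 0 < priorS π s) (i : Fin 4) (s : Fin 2) :
    M.prob s 0 i + M.prob s 1 i = priorS π s * l i s := by
  rw [← h.width_eq i s, InfoStructure.width, mul_div_cancel₀ _ (hS s).ne', Fin.sum_univ_two]

theorem probYT_values (h : HasWidths M l) (hS : ∀ s, 0 < priorS π s) :
    (M.probYT 1 0 = priorS π 0 * l 0 0 + priorS π 1 * l 0 1 ∧
      M.probYT 1 1 = priorS π 0 * l 1 0 ∧ M.probYT 1 2 = priorS π 0 * l 2 0 ∧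
      M.probYT 1 3 = 0) ∧
    (M.probYT 0 0 = 0 ∧ M.probYT 0 1 = priorS π 1 * l 1 1 ∧ M.probYT 0 2 = priorS π 1 * l 2 1 ∧
      M.probYT 0 3 = priorS π 0 * l 3 0 + priorS π 1 * l 3 1) := by
  simp only [InfoStructure.probYT_eq, ← h.sum_prob hS]
  simp [h.yellow_top, h.white_top, h.yellow_bottom, h.white_bottom]

theorem isPrivate (h : HasWidths M l) (hF : Feasible π ε l) (hε : 0 ≤ ε) : M.IsPrivate ε := by
  have he : 1 ≤ Real.exp ε := Real.one_le_exp hε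
  have hi : Real.exp ε * Real.exp (-ε) = 1 := by rw [← Real.exp_add]; simp
  have up : ∀ {x y : ℝ}, 0 ≤ y → x = Real.exp ε * y → x ≤ Real.exp ε * y ∧ y ≤ Real.exp ε * x := by
    rintro x y hy rfl
    refine ⟨le_rfl, ?_⟩
    have h1 := le_mul_of_one_le_left hy he
    exact h1.trans (le_mul_of_one_le_left (hy.trans h1) he)
  have inv : ∀ {x y : ℝ}, Real.exp (-ε) * x ≤ y → x ≤ Real.exp ε * y := by
    intro x y hxy
    have := mul_le_mul_of_nonneg_left hxy (Real.exp_pos ε).le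
    rwa [← mul_assoc, hi, one_mul] at this
  have key : ∀ i, l i 0 ≤ Real.exp ε * l i 1 ∧ l i 1 ≤ Real.exp ε * l i 0 := by
    intro i
    fin_cases i
    · exact ⟨hF.range_one.2, inv hF.range_one.1⟩
    · exact up (hF.nonneg 1 1) hF.ratio_two
    · exact (up (hF.nonneg 2 0) hF.ratio_three).symm
    · exact ⟨inv hF.range_four.1, hF.range_four.2⟩
  intro s s' i
  rw [h.width_eq, h.width_eq]
  fin_cases s <;> fin_cases s'
  · exact le_mul_of_one_le_left (hF.nonneg i 0) he
  · exact (key i).1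
  · exact (key i).2
  · exact le_mul_of_one_le_left (hF.nonneg i 1) he

/-- The optimal structure garbles into every private structure. -/
theorem exists_kernel (h : HasWidths M l) (hF : Feasible π ε l) (hS : ∀ s, 0 < priorS π s)
    (hε : 0 ≤ ε) (h₁ : l 0 0 = Real.exp ε * l 0 1 ∨ l 1 1 = 0)
    (h₀ : l 3 1 = Real.exp ε * l 3 0 ∨ l 2 0 = 0) {N : InfoStructure π T} (hN : N.IsPrivate ε) :
    ∃ k : Fin 4 → T → ℝ, (∀ i t, 0 ≤ k i t) ∧ (∀ i, HasSum (k i) 1) ∧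
      ∀ y t, ∑ i, M.probYT y i * k i t = N.probYT y t := by
  have := N.nonempty_signals
  obtain ⟨⟨a₀, a₁, a₂, a₃⟩, ⟨b₀, b₁, b₂, b₃⟩⟩ := h.probYT_values hS
  rw [hF.ratio_two] at a₁
  rw [hF.ratio_three] at b₂
  have hA := (hasSum_fintype _).unique (M.hasSum_probYT 1)
  have hB := (hasSum_fintype _).unique (M.hasSum_probYT 0)
  rw [Fin.sum_univ_four, a₀, a₁, a₂, a₃] at hA
  rw [Fin.sum_univ_four, b₀, b₁, b₂, b₃] at hB
  have he : 1 ≤ Real.exp ε := Real.one_le_exp hε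
  have hA' : priorS π 0 * l 0 0 + priorS π 1 * l 0 1 + priorS π 0 * Real.exp ε * l 1 1 +
    priorS π 0 * l 2 0 = (π (0, 1)).toReal + (π (1, 1)).toReal := by rw [← hA]; ring
  have hB' : priorS π 0 * l 3 0 + priorS π 1 * l 3 1 + priorS π 1 * l 1 1 +
    priorS π 1 * Real.exp ε * l 2 0 = (π (0, 0)).toReal + (π (1, 0)).toReal := by rw [← hB]; ring
  have c₁ := (N.hasSum_prob 1 1).mul_left (priorS π 1 + priorS π 0 * Real.exp ε)
  have c₀ := (N.hasSum_prob 0 0).mul_left (priorS π 0 + priorS π 1 * Real.exp ε)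
  rw [← priorS_mul_qS (hS 1), ← hF.bottom_left] at c₁
  rw [← priorS_mul_one_sub_qS (hS 0), ← hF.top_right] at c₀
  have t₁ : (priorS π 1 + priorS π 0 * Real.exp ε) * (priorS π 1 * l 0 1) =
      priorS π 1 * (priorS π 0 * l 0 0 + priorS π 1 * l 0 1) ∨ l 1 1 = 0 := by
    rcases h₁ with h₁ | h₁
    · left; rw [h₁]; ring
    · exact Or.inr h₁
  have t₀ : (priorS π 0 + priorS π 1 * Real.exp ε) * (priorS π 0 * l 3 0) =
      priorS π 0 * (priorS π 0 * l 3 0 + priorS π 1 * l 3 1) ∨ l 2 0 = 0 := by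
    rcases h₀ with h₀ | h₀
    · left; rw [h₀]; ring
    · exact Or.inr h₀
  obtain ⟨k, k0, k1, ka, kb⟩ := exists_kernel_of_hinge_le (hS 0) (hS 1) he
    (N.probYT_nonneg 1) (N.probYT_nonneg 0) (N.hasSum_probYT 1) (N.hasSum_probYT 0) hA' hB'
    (tsum_hinge_le (hS 0).le (hS 1).le he (N.probYT_nonneg 1) (N.probYT_nonneg 0)
      (N.hasSum_probYT 1) (N.hasSum_probYT 0) hA' hB' (hN.max_hinge_one_le hS hε) c₁
      (hN.max_hinge_zero_le hS hε) c₀ t₁ t₀)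
    -- The second hinge is the first after exchanging both the secrets and the states, which
    -- exchanges t₁ with t₄ and t₂ with t₃.
    (tsum_hinge_le (hS 1).le (hS 0).le he (N.probYT_nonneg 0) (N.probYT_nonneg 1)
      (N.hasSum_probYT 0) (N.hasSum_probYT 1) ((add_right_comm _ _ _).trans hB')
      ((add_right_comm _ _ _).trans hA')
      (hN.max_hinge_zero_le hS hε) c₀ (hN.max_hinge_one_le hS hε) c₁ t₀ t₁)
  refine ⟨k, k0, k1, fun y t => ?_⟩
  fin_cases y
  · simp only [Fin.zero_eta, Fin.sum_univ_four, b₀, b₁, b₂, b₃, ← kb t]; ring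
  · simp only [Fin.mk_one, Fin.sum_univ_four, a₀, a₁, a₂, a₃, ← ka t]; ring

/-- If the constraint on `t₁` is tight, the hinge bound is attained at each signal. -/
theorem max_hinge_one_eq (h : HasWidths M l) (hF : Feasible π ε l) (hS : ∀ s, 0 < priorS π s)
    (hε : 0 ≤ ε) (h₁ : l 0 0 = Real.exp ε * l 0 1) {N : InfoStructure π T} (hN : N.IsPrivate ε)
    (hL : N.SamePosteriorLaw M) (t : T) :
    max (priorS π 1 * N.probYT 1 t - priorS π 0 * Real.exp ε * N.probYT 0 t) 0 =
      (priorS π 1 + priorS π 0 * Real.exp ε) * N.prob 1 1 t := by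
  obtain ⟨⟨a₀, a₁, a₂, a₃⟩, ⟨b₀, b₁, b₂, b₃⟩⟩ := h.probYT_values hS
  rw [hF.ratio_two] at a₁
  rw [hF.ratio_three] at b₂
  have he : 1 ≤ Real.exp ε := Real.one_le_exp hε
  have c₁ := (N.hasSum_prob 1 1).mul_left (priorS π 1 + priorS π 0 * Real.exp ε)
  rw [← priorS_mul_qS (hS 1), ← hF.bottom_left] at c₁
  refine hL.max_eq (fun t => hN.max_hinge_one_le hS hε t) ?_ t
  suffices hs : ∑ i, max (priorS π 1 * M.probYT 1 i - priorS π 0 * Real.exp ε * M.probYT 0 i) 0 =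
      (priorS π 1 + priorS π 0 * Real.exp ε) * (priorS π 1 * l 0 1) by rwa [hs]
  have p0 := (hS 0).le
  have p1 := (hS 1).le
  have e0 : 0 ≤ Real.exp ε := by linarith
  have n₁ := hF.nonneg
  have m₂ : 0 ≤ priorS π 0 * priorS π 1 * l 2 0 := mul_nonneg (mul_nonneg p0 p1) (n₁ 2 0)
  have m₂' := le_mul_of_one_le_right m₂ (one_le_mul_of_one_le_of_one_le he he)
  -- Only t₁ contributes: t₂ lies at the kink, t₃ and t₄ on the flat side of it.
  rw [Fin.sum_univ_four, a₀, a₁, a₂, a₃, b₀, b₁, b₂, b₃, max_eq_left, max_eq_right, max_eq_right,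
    max_eq_right, h₁]
  · ring
  · have : 0 ≤ priorS π 0 * Real.exp ε * (priorS π 0 * l 3 0 + priorS π 1 * l 3 1) :=
      mul_nonneg (mul_nonneg p0 e0) (add_nonneg (mul_nonneg p0 (n₁ 3 0)) (mul_nonneg p1 (n₁ 3 1)))
    linarith
  · linarith
  · linarith
  · have : 0 ≤ priorS π 1 * (priorS π 0 * l 0 0 + priorS π 1 * l 0 1) :=
      mul_nonneg p1 (add_nonneg (mul_nonneg p0 (n₁ 0 0)) (mul_nonneg p1 (n₁ 0 1)))
    linarith

/-- If the constraint on `t₄` is tight, the hinge bound is attained at each signal. -/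
theorem max_hinge_zero_eq (h : HasWidths M l) (hF : Feasible π ε l) (hS : ∀ s, 0 < priorS π s)
    (hε : 0 ≤ ε) (h₀ : l 3 1 = Real.exp ε * l 3 0) {N : InfoStructure π T} (hN : N.IsPrivate ε)
    (hL : N.SamePosteriorLaw M) (t : T) :
    max (priorS π 0 * N.probYT 0 t - priorS π 1 * Real.exp ε * N.probYT 1 t) 0 =
      (priorS π 0 + priorS π 1 * Real.exp ε) * N.prob 0 0 t := by
  obtain ⟨⟨a₀, a₁, a₂, a₃⟩, ⟨b₀, b₁, b₂, b₃⟩⟩ := h.probYT_values hS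
  rw [hF.ratio_two] at a₁
  rw [hF.ratio_three] at b₂
  have he : 1 ≤ Real.exp ε := Real.one_le_exp hε
  have c₀ := (N.hasSum_prob 0 0).mul_left (priorS π 0 + priorS π 1 * Real.exp ε)
  rw [← priorS_mul_one_sub_qS (hS 0), ← hF.top_right] at c₀
  -- The decreasing hinge is brought to the form r x - s y with negative coefficients.
  have sw : ∀ x y : ℝ, -(priorS π 1 * Real.exp ε) * x - -priorS π 0 * y =
      priorS π 0 * y - priorS π 1 * Real.exp ε * x := fun x y => by ring
  rw [← sw]
  refine hL.max_eq (f := fun t => (priorS π 0 + priorS π 1 * Real.exp ε) * N.prob 0 0 t)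
    (fun t => (sw _ _).symm ▸ hN.max_hinge_zero_le hS hε t) ?_ t
  simp only [sw]
  suffices hs : ∑ i, max (priorS π 0 * M.probYT 0 i - priorS π 1 * Real.exp ε * M.probYT 1 i) 0 =
      (priorS π 0 + priorS π 1 * Real.exp ε) * (priorS π 0 * l 3 0) by rwa [hs]
  have p0 := (hS 0).le
  have p1 := (hS 1).le
  have e0 : 0 ≤ Real.exp ε := by linarith
  have n₁ := hF.nonneg
  have m₂ : 0 ≤ priorS π 0 * priorS π 1 * l 1 1 := mul_nonneg (mul_nonneg p0 p1) (n₁ 1 1)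
  have m₂' := le_mul_of_one_le_right m₂ (one_le_mul_of_one_le_of_one_le he he)
  rw [Fin.sum_univ_four, a₀, a₁, a₂, a₃, b₀, b₁, b₂, b₃, max_eq_right, max_eq_right, max_eq_right,
    max_eq_left, h₀]
  · ring
  · have : 0 ≤ priorS π 0 * (priorS π 0 * l 3 0 + priorS π 1 * l 3 1) :=
      mul_nonneg p0 (add_nonneg (mul_nonneg p0 (n₁ 3 0)) (mul_nonneg p1 (n₁ 3 1)))
    linarith
  · linarith
  · linarith
  · have : 0 ≤ priorS π 1 * Real.exp ε * (priorS π 0 * l 0 0 + priorS π 1 * l 0 1) :=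
      mul_nonneg (mul_nonneg p1 e0) (add_nonneg (mul_nonneg p0 (n₁ 0 0)) (mul_nonneg p1 (n₁ 0 1)))
    linarith

/-! ### Uniqueness up to merging and splitting. -/

/-- Signals that are not fully revealing are yellow on top and white at the bottom. -/
theorem prob_eq_zero_of_postY_ne (h : HasWidths M l) (hF : Feasible π ε l)
    (hS : ∀ s, 0 < priorS π s) (hε : 0 ≤ ε) (h₁ : l 0 0 = Real.exp ε * l 0 1 ∨ l 1 1 = 0)
    (h₀ : l 3 1 = Real.exp ε * l 3 0 ∨ l 2 0 = 0) {N : InfoStructure π T} (hN : N.IsPrivate ε)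
    (hL : N.SamePosteriorLaw M) {t : T} (ht : N.probT t ≠ 0) (ht0 : N.postY t ≠ 0)
    (ht1 : N.postY t ≠ 1) : N.prob 1 1 t = 0 ∧ N.prob 0 0 t = 0 := by
  obtain ⟨⟨a₀, a₁, a₂, a₃⟩, ⟨b₀, b₁, b₂, b₃⟩⟩ := h.probYT_values hS
  rw [hF.ratio_two] at a₁
  rw [hF.ratio_three] at b₂
  have c₁ : 0 < priorS π 1 + priorS π 0 * Real.exp ε :=
    add_pos (hS 1) (mul_pos (hS 0) (Real.exp_pos ε))
  have c₀ : 0 < priorS π 0 + priorS π 1 * Real.exp ε :=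
    add_pos (hS 0) (mul_pos (hS 1) (Real.exp_pos ε))
  have n11 := N.prob_nonneg 1 1 t
  have n00 := N.prob_nonneg 0 0 t
  obtain ⟨i, hi, hx⟩ := hL.exists_postY_eq ht
  have ea := M.probT_mul_postY i
  have eb := M.probT_mul_one_sub_postY i
  have fa := N.probT_mul_postY t
  have fb := N.probT_mul_one_sub_postY t
  rw [hx] at ea eb
  have hi' : i = 0 ∨ i = 1 ∨ i = 2 ∨ i = 3 := by fin_cases i <;> simp
  rcases hi' with rfl | rfl | rfl | rfl
  · rw [b₀] at eb
    exact absurd ((mul_eq_zero.1 eb).resolve_left hi) (sub_ne_zero.2 ht1.symm)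
  · rw [a₁] at ea
    rw [b₁] at eb
    -- The kink t₂ carries mass, so complementary slackness makes the constraint on t₁ tight and the
    -- hinge bound is an equality at `t`.
    have hl : l 1 1 ≠ 0 := by
      intro hl
      rw [hl, mul_zero, mul_zero] at ea
      exact (mul_ne_zero hi ht0) ea
    have hz : priorS π 1 * N.postY t - priorS π 0 * Real.exp ε * (1 - N.postY t) = 0 := by
      refine (mul_eq_zero.1 (?_ : M.probT 1 * _ = 0)).resolve_left hi
      linear_combination priorS π 1 * ea - priorS π 0 * Real.exp ε * eb
    have hF0 : priorS π 1 * N.probYT 1 t - priorS π 0 * Real.exp ε * N.probYT 0 t = 0 := by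
      rw [← fa, ← fb]; linear_combination N.probT t * hz
    have hm := h.max_hinge_one_eq hF hS hε (h₁.resolve_right hl) hN hL t
    have hh := hN.hinge_one hS hε t
    rw [hF0, max_self] at hm
    have h11 := (mul_eq_zero.1 hm.symm).resolve_left c₁.ne'
    rw [hF0, h11] at hh
    have := nonneg_of_mul_nonneg_right hh c₁
    exact ⟨h11, by linarith⟩
  · rw [a₂] at ea
    rw [b₂] at eb
    have hl : l 2 0 ≠ 0 := by
      intro hl
      rw [hl, mul_zero] at ea
      exact (mul_ne_zero hi ht0) ea
    have hz : priorS π 0 * (1 - N.postY t) - priorS π 1 * Real.exp ε * N.postY t = 0 := by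
      refine (mul_eq_zero.1 (?_ : M.probT 2 * _ = 0)).resolve_left hi
      linear_combination priorS π 0 * eb - priorS π 1 * Real.exp ε * ea
    have hF0 : priorS π 0 * N.probYT 0 t - priorS π 1 * Real.exp ε * N.probYT 1 t = 0 := by
      rw [← fa, ← fb]; linear_combination N.probT t * hz
    have hm := h.max_hinge_zero_eq hF hS hε (h₀.resolve_right hl) hN hL t
    have hh := hN.hinge_zero hS hε t
    rw [hF0, max_self] at hm
    have h00 := (mul_eq_zero.1 hm.symm).resolve_left c₀.ne'
    rw [hF0, h00] at hh
    have := nonneg_of_mul_nonneg_right hh c₀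
    exact ⟨by linarith, h00⟩
  · rw [a₃] at ea
    exact absurd ((mul_eq_zero.1 ea).resolve_left hi) ht0

end HasWidths

/-- The conditional law of `(S, Y)` given a signal of the optimal structure with posterior `x`,
where `p`, `q` are the prior probabilities of the two secrets and `e = exp ε`. -/
noncomputable def posteriorShape (p q e x : ℝ) : Matrix (Fin 2) (Fin 2) ℝ :=
  open Classical in
  if x = 1 then !![0, p * e / (q + p * e); 0, q / (q + p * e)]
  else if x = 0 then !![p / (p + q * e), 0; q * e / (p + q * e), 0]
  else !![0, x; 1 - x, 0]

namespace HasWidths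

variable {π : PMF (Fin 2 × Fin 2)} {T : Type*} {ε : ℝ} {l : Fin 4 → Fin 2 → ℝ}
  {M : InfoStructure π (Fin 4)}

/-- At a revealing posterior outside `slackValues` the constraint is tight, and equality in the
hinge bound fixes how the mass divides between the secrets. At an inner posterior only the cells
(s₀, 1) and (s₁, 0) survive, so the posterior determines both. -/
theorem prob_eq_posteriorShape (h : HasWidths M l) (hF : Feasible π ε l)
    (hS : ∀ s, 0 < priorS π s) (hε : 0 ≤ ε) (h₁ : l 0 0 = Real.exp ε * l 0 1 ∨ l 1 1 = 0)
    (h₀ : l 3 1 = Real.exp ε * l 3 0 ∨ l 2 0 = 0) {N : InfoStructure π T} (hN : N.IsPrivate ε)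
    (hL : N.SamePosteriorLaw M) {t : T} (hE : N.postY t ∉ slackValues ε l) (s y : Fin 2) :
    N.prob s y t =
      posteriorShape (priorS π 0) (priorS π 1) (Real.exp ε) (N.postY t) s y * N.probT t := by
  have c₁ : 0 < priorS π 1 + priorS π 0 * Real.exp ε :=
    add_pos (hS 1) (mul_pos (hS 0) (Real.exp_pos ε))
  have c₀ : 0 < priorS π 0 + priorS π 1 * Real.exp ε :=
    add_pos (hS 0) (mul_pos (hS 1) (Real.exp_pos ε))
  have n := fun s y => N.prob_nonneg s y t
  have fa := N.probT_mul_postY t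
  have fb := N.probT_mul_one_sub_postY t
  have eT := N.probT_eq t
  have ea := N.probYT_eq 1 t
  have eb := N.probYT_eq 0 t
  by_cases ht : N.probT t = 0
  · have : N.prob s y t = 0 := by
      have := n 0 0; have := n 0 1; have := n 1 0; have := n 1 1
      fin_cases s <;> fin_cases y <;> simp only [Fin.zero_eta, Fin.mk_one] <;> linarith
    rw [this, ht, mul_zero]
  suffices hs : ∀ c, c = posteriorShape (priorS π 0) (priorS π 1) (Real.exp ε) (N.postY t) →
      N.prob 0 0 t = c 0 0 * N.probT t ∧ N.prob 0 1 t = c 0 1 * N.probT t ∧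
      N.prob 1 0 t = c 1 0 * N.probT t ∧ N.prob 1 1 t = c 1 1 * N.probT t by
    obtain ⟨s00, s01, s10, s11⟩ := hs _ rfl
    fin_cases s <;> fin_cases y <;> assumption
  rintro _ rfl
  by_cases x1 : N.postY t = 1
  · have tight : l 0 0 = Real.exp ε * l 0 1 :=
      hF.range_one.2.antisymm (not_lt.1 fun hlt => hE (Or.inl ⟨x1, hlt⟩))
    have hm := h.max_hinge_one_eq hF hS hε tight hN hL t
    rw [x1, sub_self, mul_zero] at fb
    have z0 : N.prob 0 0 t = 0 := by linarith [n 0 0, n 1 0]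
    have z1 : N.prob 1 0 t = 0 := by linarith [n 0 0, n 1 0]
    rw [← fb, mul_zero, sub_zero, max_eq_left (mul_nonneg (hS 1).le (N.probYT_nonneg 1 t))] at hm
    rw [x1, z0, z1]
    simp only [posteriorShape, if_true]
    refine ⟨by simp, ?_, by simp, ?_⟩
    · simp only [Matrix.of_apply, Matrix.cons_val]
      field_simp
      rw [eT]
      linear_combination -(priorS π 1 + priorS π 0 * Real.exp ε) * ea + hm + priorS π 0 * Real.exp ε * fb
    · simp only [Matrix.of_apply, Matrix.cons_val]
      field_simp
      rw [eT]
      linear_combination -hm + priorS π 1 * fb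
  by_cases x0 : N.postY t = 0
  · have tight : l 3 1 = Real.exp ε * l 3 0 :=
      hF.range_four.2.antisymm (not_lt.1 fun hlt => hE (Or.inr ⟨x0, hlt⟩))
    have hm := h.max_hinge_zero_eq hF hS hε tight hN hL t
    rw [x0, mul_zero] at fa
    have z0 : N.prob 0 1 t = 0 := by linarith [n 0 1, n 1 1]
    have z1 : N.prob 1 1 t = 0 := by linarith [n 0 1, n 1 1]
    rw [← fa, mul_zero, sub_zero, max_eq_left (mul_nonneg (hS 0).le (N.probYT_nonneg 0 t))] at hm
    rw [x0, z0, z1]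
    simp only [posteriorShape, if_true, zero_ne_one, if_false]
    refine ⟨?_, by simp, ?_, by simp⟩
    · simp only [Matrix.of_apply, Matrix.cons_val]
      field_simp
      rw [eT]
      linear_combination -hm + priorS π 0 * fa
    · simp only [Matrix.of_apply, Matrix.cons_val]
      field_simp
      rw [eT]
      linear_combination -(priorS π 0 + priorS π 1 * Real.exp ε) * eb + hm + priorS π 1 * Real.exp ε * fa
  · obtain ⟨z11, z00⟩ := h.prob_eq_zero_of_postY_ne hF hS hε h₁ h₀ hN hL ht x0 x1
    simp only [posteriorShape, x1, x0, if_false]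
    refine ⟨by simp [z00], ?_, ?_, by simp [z11]⟩
    · simp; linarith
    · simp; linarith

/-- Private structures with the same posterior law as the optimal one are equivalent to it. -/
theorem equivalent (h : HasWidths M l) (hF : Feasible π ε l)
    (hS : ∀ s, 0 < priorS π s) (hε : 0 ≤ ε) (h₁ : l 0 0 = Real.exp ε * l 0 1 ∨ l 1 1 = 0)
    (h₀ : l 3 1 = Real.exp ε * l 3 0 ∨ l 2 0 = 0) {N : InfoStructure π T} (hN : N.IsPrivate ε)
    (hL : N.SamePosteriorLaw M) : N.Equivalent (slackValues ε l) M := by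
  have hM := h.isPrivate hF hε
  have hLM : M.SamePosteriorLaw M := fun φ => hasSum_fintype _
  have sN := fun t => h.prob_eq_posteriorShape hF hS hε h₁ h₀ hN hL (t := t)
  have sM := fun t => h.prob_eq_posteriorShape hF hS hε h₁ h₀ hM hLM (t := t)
  refine ⟨ℝ, N.byPosterior, N.mergesTo_byPosterior fun x hx =>
    ⟨posteriorShape (priorS π 0) (priorS π 1) (Real.exp ε) x, ?_⟩, ?_⟩
  · rintro t rfl; exact sN t hx
  · rw [hL.byPosterior_eq fun x x0 x1 => ?_]
    · refine M.mergesTo_byPosterior fun x hx =>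
        ⟨posteriorShape (priorS π 0) (priorS π 1) (Real.exp ε) x, ?_⟩
      rintro t rfl; exact sM t hx
    · have hx : x ∉ slackValues ε l := by
        rintro (⟨hx, -⟩ | ⟨hx, -⟩)
        exacts [x1 hx, x0 hx]
      refine ⟨posteriorShape (priorS π 0) (priorS π 1) (Real.exp ε) x, ?_, ?_⟩
      · rintro t rfl; exact sN t hx
      · rintro t rfl; exact sM t hx

theorem blackwellOptimal (h : HasWidths M l) (hF : Feasible π ε l)
    (hS : ∀ s, 0 < priorS π s) (hε : 0 ≤ ε) (h₁ : l 0 0 = Real.exp ε * l 0 1 ∨ l 1 1 = 0)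
    (h₀ : l 3 1 = Real.exp ε * l 3 0 ∨ l 2 0 = 0) : M.IsBlackwellOptimal ε := by
  refine ⟨h.isPrivate hF hε, fun T₁ M₁ hM₁ _ => ?_⟩
  obtain ⟨k, k0, k1, hk⟩ := h.exists_kernel hF hS hε h₁ h₀ hM₁
  exact InfoStructure.dominates_of_sum k0 k1 hk

/-- The four-signal structure dominates `N`, so optimality of `N` gives the reverse domination.
Jensen for x² along the first garbling bounds the second moment as the equality case along the
second requires. -/
theorem equivalent_of_isBlackwellOptimal (h : HasWidths M l) (hF : Feasible π ε l)
    (hS : ∀ s, 0 < priorS π s) (hε : 0 ≤ ε) (h₁ : l 0 0 = Real.exp ε * l 0 1 ∨ l 1 1 = 0)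
    (h₀ : l 3 1 = Real.exp ε * l 3 0 ∨ l 2 0 = 0) {N : InfoStructure π T}
    (hN : N.IsBlackwellOptimal ε) : N.Equivalent (slackValues ε l) M := by
  obtain ⟨k, k0, k1, hk⟩ := h.exists_kernel hF hS hε h₁ h₀ hN.1
  have hd := hN.2 _ M (h.isPrivate hF hε) (InfoStructure.dominates_of_sum k0 k1 hk)
  have hu : ConvexOn ℝ (Set.Icc (0 : ℝ) 1) fun x => x ^ 2 :=
    (even_two.convexOn_pow).subset (Set.subset_univ _) (convex_Icc 0 1)
  obtain ⟨hs, hle⟩ := InfoStructure.summable_and_expectedUtility_le_of_kernel k0 k1 hk hu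
  refine h.equivalent hF hS hε h₁ h₀ hN.1 (hd.samePosteriorLaw hs ?_)
  rwa [InfoStructure.expectedUtility, InfoStructure.expectedUtility,
    tsum_fintype (fun i => M.probT i * M.postY i ^ 2)] at hle

end HasWidths

/-! ### Existence of the four-signal structure and conclusion. -/

/-- The masses of the four-signal structure with cell widths `l`. -/
noncomputable def cellMass (π : PMF (Fin 2 × Fin 2)) (l : Fin 4 → Fin 2 → ℝ)
    (x : Fin 2 × Fin 2 × Fin 4) : ℝ :=
  if (x.2.1 = 1 ↔ (x.1 = 0 ∧ x.2.2 ≠ 3) ∨ (x.1 = 1 ∧ x.2.2 = 0)) then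
    priorS π x.1 * l x.2.2 x.1 else 0

theorem Feasible.exists_hasWidths {π : PMF (Fin 2 × Fin 2)} {ε : ℝ} {l : Fin 4 → Fin 2 → ℝ}
    (hF : Feasible π ε l) (hS : ∀ s, 0 < priorS π s) :
    ∃ M : InfoStructure π (Fin 4), HasWidths M l := by
  have h0 : ∀ x, 0 ≤ cellMass π l x := fun x => by
    unfold cellMass
    split_ifs
    exacts [mul_nonneg (hS _).le (hF.nonneg _ _), le_rfl]
  have s0 := hF.sum_eq_one 0
  have s1 := hF.sum_eq_one 1
  rw [Fin.sum_univ_four] at s0 s1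
  have hm : ∀ s y, ∑ i, cellMass π l (s, y, i) = (π (s, y)).toReal := by
    have e₁ := hF.bottom_left
    have e₂ := hF.top_right
    intro s y
    fin_cases s <;> fin_cases y
    · simp [cellMass, ← priorS_mul_one_sub_qS (hS 0), e₂]
    · simp [Fin.sum_univ_four, cellMass, ← priorS_mul_qS (hS 0)]
      linear_combination priorS π 0 * s0 - priorS π 0 * e₂
    · simp [Fin.sum_univ_four, cellMass, ← priorS_mul_one_sub_qS (hS 1)]
      linear_combination priorS π 1 * s1 - priorS π 1 * e₁
    · simp [cellMass, ← priorS_mul_qS (hS 1), e₁]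
  have h1 : HasSum (cellMass π l) 1 := by
    have h := hasSum_fintype (cellMass π l)
    have e : ∑ x, cellMass π l x = 1 := by
      rw [← (hasSum_fintype _).unique π.hasSum_toReal, Fintype.sum_prod_type,
        Fintype.sum_prod_type]
      refine sum_congr rfl fun s _ => ?_
      rw [Fintype.sum_prod_type]
      exact sum_congr rfl fun y _ => hm s y
    rwa [e] at h
  refine ⟨⟨PMF.ofReal (cellMass π l) h0 h1, PMF.ext_toReal ?_⟩, ?_⟩
  · rintro ⟨s, y⟩
    have h := (PMF.ofReal (cellMass π l) h0 h1).hasSum_map_toReal (fun x => (x.1, x.2.1)) (s, y)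
    refine h.unique ?_
    rw [← hm]
    have := hasSum_fintype (fun x : Fin 2 × Fin 2 × Fin 4 =>
      if (s, y) = (x.1, x.2.1) then (PMF.ofReal (cellMass π l) h0 h1 x).toReal else 0)
    convert this using 1
    simp only [PMF.ofReal_apply_toReal, Fintype.sum_prod_type, Prod.mk.injEq]
    rw [sum_eq_single s, sum_eq_single y]
    · simp
    · intro b _ hb; simp [hb.symm]
    · simp
    · intro b _ hb; simp [hb.symm]
    · simp
  · have p0 := (hS 0).ne'
    have p1 := (hS 1).ne'
    refine ⟨?_, ?_, ?_, ?_, ?_⟩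
    · intro i j
      fin_cases i <;> fin_cases j <;>
        simp [InfoStructure.width, InfoStructure.prob, cellMass, p0, p1]
    · intro i hi; simp [InfoStructure.prob, cellMass, hi]
    · simp [InfoStructure.prob, cellMass]
    · simp [InfoStructure.prob, cellMass]
    · intro i hi; simp [InfoStructure.prob, cellMass, hi]

theorem exists_feasible_closedForm {π : PMF (Fin 2 × Fin 2)} {ε : ℝ} (hε : 0 ≤ ε)
    (hS : ∀ s, 0 < priorS π s) (hq : qS π 1 ≤ qS π 0) :
    ∃ l : Fin 4 → Fin 2 → ℝ, Feasible π ε l ∧ ClosedForm π ε l ∧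
      (l 0 0 = Real.exp ε * l 0 1 ∨ l 1 1 = 0) ∧ (l 3 1 = Real.exp ε * l 3 0 ∨ l 2 0 = 0) := by
  have he := Real.one_le_exp hε
  have e0 := Real.exp_pos ε
  have y0 := qS_nonneg π 1
  have x1 := qS_le_one (hS 0)
  obtain ⟨l, k, hl, hk, r₁, r₄, c₁, c₀, f₁, f₂, f₃, f₄⟩ :=
    exists_optimal_widths he y0 hq x1
  rw [← Real.exp_neg] at r₁ r₄ f₃ f₄
  have R₁ : ratioOne π ≤ ENNReal.ofReal (Real.exp ε) ↔ qS π 0 ≤ Real.exp ε * qS π 1 :=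
    ofReal_div_le_ofReal_iff (qS_nonneg π 0) y0 e0.le
  have R₂ : ratioTwo π ≤ ENNReal.ofReal (Real.exp ε) ↔
      1 - qS π 1 ≤ Real.exp ε * (1 - qS π 0) :=
    ofReal_div_le_ofReal_iff (by linarith [qS_le_one (hS 1)]) (by linarith) e0.le
  have R₁' := (not_congr R₁)
  have R₂' := (not_congr R₂)
  rw [not_le, not_le] at R₁' R₂'
  have e2 : Real.exp (2 * ε) = Real.exp ε ^ 2 := by rw [← Real.exp_nat_mul]; norm_num
  -- The widths of (s₀, t₁) and (s₁, t₄) are whatever the conditional laws given s₀ and s₁ still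
  -- lack to total one.
  refine ⟨![![qS π 0 - Real.exp ε * l - k, qS π 1], ![Real.exp ε * l, l], ![k, Real.exp ε * k],
    ![1 - qS π 0, 1 - qS π 1 - l - Real.exp ε * k]], ⟨rfl, rfl, rfl, rfl, r₁, r₄, ?_, ?_⟩,
    ⟨?_, ?_, ?_, ?_⟩, c₁, c₀⟩
  · intro j
    fin_cases j
    · simp [Fin.sum_univ_four]; ring
    · simp [Fin.sum_univ_four]
  · have m₁ := mul_nonneg (Real.exp_pos (-ε)).le y0
    have m₂ := mul_nonneg (Real.exp_pos (-ε)).le (sub_nonneg.2 x1)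
    intro i j
    fin_cases i <;> fin_cases j
    · exact m₁.trans r₁.1
    · exact y0
    · exact mul_nonneg e0.le hl
    · exact hl
    · exact hk
    · exact mul_nonneg e0.le hk
    · exact sub_nonneg.2 x1
    · exact m₂.trans r₄.1
  · rw [R₁, R₂]; exact f₁
  · rw [gt_iff_lt, gt_iff_lt, R₁, R₁', R₂', ge_iff_le]; exact f₂
  · rw [gt_iff_lt, gt_iff_lt, R₁', R₂, R₂']; exact f₃
  · rw [gt_iff_lt, gt_iff_lt, gt_iff_lt, R₁', R₂', e2]; exact f₄

theorem theorem5p1 (π : PMF (Fin 2 × Fin 2)) (ε : ℝ) (hε : 0 ≤ ε)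
    (hS : ∀ s, 0 < priorS π s) (hq : qS π 1 ≤ qS π 0) :
    ∃ l : Fin 4 → Fin 2 → ℝ, Feasible π ε l ∧ ClosedForm π ε l ∧
      ∃ M : InfoStructure π (Fin 4), HasWidths M l ∧
        M.IsBlackwellOptimal ε ∧
        (∀ (T : Type*) (M' : InfoStructure π T), M'.IsBlackwellOptimal ε →
          M'.Equivalent (slackValues ε l) M) ∧
        (∀ u : ℝ → ℝ, ConvexOn ℝ (Set.Icc 0 1) u →
          ∀ (T : Type*) (M' : InfoStructure π T), M'.IsPrivate ε →
            Summable (fun t => M'.probT t * u (M'.postY t)) ∧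
            M'.expectedUtility u ≤ M.expectedUtility u) := by
  obtain ⟨l, hF, hC, h₁, h₀⟩ := exists_feasible_closedForm hε hS hq
  obtain ⟨M, hM⟩ := hF.exists_hasWidths hS
  refine ⟨l, hF, hC, M, hM, hM.blackwellOptimal hF hS hε h₁ h₀,
    fun T M' hM' => hM.equivalent_of_isBlackwellOptimal hF hS hε h₁ h₀ hM',
    fun u hu T M' hM' => ?_⟩
  obtain ⟨k, k0, k1, hk⟩ := hM.exists_kernel hF hS hε h₁ h₀ hM'
  exact InfoStructure.summable_and_expectedUtility_le_of_kernel k0 k1 hk hu
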